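/- Let $k$ be a field of characteristic zero and $r\in\mathbb N$. A \emph{geometric data of rank $r$} over $k$ is a tuple $(X,C,P,\mathcal F,\pi,\phi)$ as follows. (1) $X$ is an integral projective scheme of dimension $2$ over $k$. (2) $C\subset X$ is a prime Weil divisor, not contained in the singular locus of $X$, which is an ample $\mathbb Q$-Cartier divisor: for some $l>0$ the Weil divisor $lC$ is the cycle of an ample effective Cartier divisor. Let $d>0$ be the smallest integer such that $dC$ is the cycle of a very ample effective Cartier divisor, and let $C'$ be such a very ample effective Cartier divisor with cycle $dC$. (3) $P\in C$ is a closed $k$-rational point which is regular on $C$ and on $X$; let $f\in\mathcal O_{X,P}$ be a local equation of $C$ at $P$. (4) $\pi:\widehat{\mathcal O}_{X,P}\to k[[u,t]]$ is a local homomorphism of $k$-algebras such that $\pi(f)k[[u,t]]=t^rk[[u,t]]$ and such that the induced map $\widehat{\mathcal O}_{C,P}=\widehat{\mathcal O}_{X,P}/(f)\to k[[u,t]]/(t)=k[[u]]$ is an isomorphism. (5) $\mathcal F$ is a torsion free quasi-coherent sheaf on $X$. (6) $\phi:\mathcal F_P\hookrightarrow k[[u,t]]$ is an injective homomorphism of $\mathcal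 O_{X,P}$-modules (where $\mathcal O_{X,P}$ acts on $k[[u,t]]$ through $\pi$) such that for every $n\ge 0$ the composite $$H^0(X,\mathcal F(nC'))\hookrightarrow \mathcal F(nC')_P\xrightarrow{\ \cdot f^{nd}\ }\mathcal F_P\xrightarrow{\ \phi\ }k[[u,t]]\to k[[u,t]]/(u,t)^{ndr+1}$$ is an isomorphism. Statement. If the sheaf $\mathcal F$ of a geometric data of rank $r$ is coherent, then $\mathcal F$ is Cohen--Macaulay along $C$: for every point $Q\in C$ the stalk $\mathcal F_Q$ is a nonzero finitely generated Cohen--Macaulay $\mathcal O_{X,Q}$-module, that is, $\operatorname{depth}\mathcal F_Q=\dim\bigl(\mathcal O_{X,Q}/\operatorname{Ann}\mathcal F_Q\bigr)$; and $\operatorname{depth}\mathcal F_Q=2$ for every closed point $Q\in C$. In particular, $\mathcal F_P$ is a free $\mathcal O_{X,P}$-module. -/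

import Mathlib

open AlgebraicGeometry CategoryTheory TopologicalSpace

universe u

noncomputable section

namespace GeomData

/-! ### Commutative algebra: depth and Cohen-Macaulay modules -/

/-- The depth of a module `M` over a local ring `R`: the supremum of the lengths of the `M`-regular
sequences that consist of elements of the maximal ideal. -/
def depth (R : Type*) [CommRing R] [IsLocalRing R] (M : Type*) [AddCommGroup M] [Module R M] :
    ℕ∞ :=
  ⨆ rs : {rs : List R // RingTheory.Sequence.IsRegular M rs ∧
    ∀ a ∈ rs, a ∈ IsLocalRing.maximalIdeal R}, (rs.1.length : ℕ∞)

/-- A nonzero finitely generated module over a (Noetherian) local ring is Cohen-Macaulay if its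
depth equals the dimension `dim (R / Ann M)` of its support. -/
structure IsCohenMacaulay (R : Type*) [CommRing R] [IsLocalRing R] (M : Type*) [AddCommGroup M]
    [Module R M] : Prop where
  finite : Module.Finite R M
  nontrivial : Nontrivial M
  depth_eq : ((depth R M : ℕ∞) : WithBot ℕ∞) = Module.supportDim R M

/-! ### Stalks of sheaves of modules -/

section Sheaves

variable {X : Scheme.{u}}

/-- The module structure on the stalks of a presheaf of modules, as given by Mathlib. -/
@[reducible] def stalkModuleAux {T : TopCat.{u}} {R : T.Presheaf CommRingCat.{u}}
    (M : PresheafOfModules.{u} (R ⋙ forget₂ CommRingCat.{u} RingCat.{u})) (x : T) :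
    Module (R.stalk x) ↑(TopCat.Presheaf.stalk M.presheaf x) :=
  inferInstance

/-- The stalk `𝓕_x` of a sheaf of `𝓞_X`-modules. -/
abbrev mstalk (F : X.Modules) (x : X) : Type u :=
  ↑(TopCat.Presheaf.stalk F.presheaf x)

instance (F : X.Modules) (x : X) : Module (X.presheaf.stalk x) (mstalk F x) :=
  stalkModuleAux (R := X.presheaf) F.val x

/-- The cospecialization map `𝓕_x → 𝓕_y` for `y` a generization of `x`. -/
def cosp (F : X.Modules) {x y : X} (h : y ⤳ x) : mstalk F x →+ mstalk F y :=
  (TopCat.Presheaf.stalkSpecializes F.presheaf h).hom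

/-- Coherent sheaves on a locally Noetherian scheme: quasi-coherent and of finite type. -/
def IsCoherent (F : X.Modules) : Prop :=
  F.IsQuasicoherent ∧ F.IsFiniteType

/-- A sheaf of modules is torsion free if all its stalks are torsion free modules. -/
def IsTorsionFree (F : X.Modules) : Prop :=
  ∀ x : X, Module.IsTorsionFree (X.presheaf.stalk x) (mstalk F x)

end Sheaves

/-! ### Effective Cartier divisors -/

/-- An effective Cartier divisor `E` on `X`, given by its ideal sheaf `𝓞_X(-E)`. The ideal sheaf is
recorded by its stalks, which locally on `X` are generated by the germs of one section `g` that is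
a nonzerodivisor in every local ring (so `g` is a local equation of `E`). -/
structure EffCartier (X : Scheme.{u}) where
  /-- The stalk `𝓞_X(-E)_x`, generated by any local equation of `E` at `x`. -/
  ideal : ∀ x : X, Ideal (X.presheaf.stalk x)
  locally_principal : ∀ x : X, ∃ (U : X.Opens) (_ : x ∈ U) (g : Γ(X, U)),
    ∀ (y : X) (hy : y ∈ U),
      X.presheaf.germ U y hy g ∈ nonZeroDivisors (X.presheaf.stalk y) ∧
      ideal y = Ideal.span {X.presheaf.germ U y hy g}

/-- The multiple `nE` of an effective Cartier divisor; its local equations are the `n`-th powers of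
those of `E`. -/
def EffCartier.mul {X : Scheme.{u}} (n : ℕ) (E : EffCartier X) : EffCartier X where
  ideal x := E.ideal x ^ n
  locally_principal x := by
    obtain ⟨U, hx, g, hg⟩ := E.locally_principal x
    refine ⟨U, hx, g ^ n, fun y hy => ⟨?_, ?_⟩⟩
    · rw [map_pow]
      exact pow_mem (hg y hy).1 n
    · rw [(hg y hy).2, Ideal.span_singleton_pow, map_pow]

section Twist

variable {X : Scheme.{u}} [IsIntegral X]

/-- The global sections `H⁰(X, 𝓕(E))` of the twist of a torsion free quasi-coherent sheaf `𝓕` on an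
integral scheme by an effective Cartier divisor. The sheaf `𝓕(E)` is the subsheaf of the constant
sheaf with value the generic stalk `𝓕_η` whose stalk at `x` is `g⁻¹ 𝓕_x`, where `g` is a local
equation of `E` at `x`. -/
def twistSections (F : X.Modules) (E : EffCartier X) :
    AddSubgroup (mstalk F (genericPoint X)) where
  carrier := {s | ∀ x : X, ∀ g ∈ E.ideal x,
    algebraMap (X.presheaf.stalk x) X.functionField g • s ∈
      (cosp F ((genericPoint_spec X).specializes (Set.mem_univ x))).range}
  zero_mem' x g _ := by
    rw [smul_zero]
    exact zero_mem _
  add_mem' hs ht x g hg := by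
    rw [smul_add]
    exact add_mem (hs x g hg) (ht x g hg)
  neg_mem' hs x g hg := by
    rw [smul_neg]
    exact neg_mem (hs x g hg)

end Twist

/-! ### Projective space, very ample and ample divisors -/

section Projective

variable (k : Type u) [Field k]

/-- The standard grading of `k[X_0, …, X_n]`. -/
abbrev grading (n : ℕ) : ℕ → Submodule k (MvPolynomial (Fin (n + 1)) k) :=
  MvPolynomial.homogeneousSubmodule (Fin (n + 1)) k

instance (n : ℕ) : GradedAlgebra (grading k n) := MvPolynomial.gradedAlgebra

/-- The projective space `ℙⁿ` over `k`. -/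
abbrev projSpace (n : ℕ) : Scheme.{u} := Proj (grading k n)

/-- The structure morphism of `ℙⁿ` over `k`. -/
def projSpaceStr (n : ℕ) : projSpace k n ⟶ Spec (.of k) :=
  Proj.toSpecZero (grading k n) ≫
    Spec.map (CommRingCat.ofHom (algebraMap k (grading k n 0)))

/-- The standard open subset `X_i ≠ 0` of `ℙⁿ`. -/
abbrev stdOpen (n : ℕ) (i : Fin (n + 1)) : (projSpace k n).Opens :=
  Proj.basicOpen (grading k n) (MvPolynomial.X i)

/-- The regular function `X_j / X_i` on the open subset `X_i ≠ 0` of `ℙⁿ`. -/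
def coordRatio (n : ℕ) (j i : Fin (n + 1)) : Γ(projSpace k n, stdOpen k n i) :=
  (Proj.awayToSection (grading k n) (MvPolynomial.X i)).hom
    (HomogeneousLocalization.Away.mk (grading k n) (d := 1)
      (MvPolynomial.isHomogeneous_X k i) 1 (MvPolynomial.X j)
      (by simpa using MvPolynomial.isHomogeneous_X k j))

variable {k} {X : Scheme.{u}}

/-- `X` is projective over `k`: it is a closed subscheme of some `ℙⁿ`. -/
def IsProjective (p : X ⟶ Spec (.of k)) : Prop :=
  ∃ (n : ℕ) (i : X ⟶ projSpace k n), IsClosedImmersion i ∧ i ≫ projSpaceStr k n = p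

/-- The structure homomorphism `k → 𝓞_{X,x}` of a scheme over `k`. -/
def scalar (p : X ⟶ Spec (.of k)) (x : X) : k →+* X.presheaf.stalk x :=
  (X.presheaf.germ ⊤ x trivial).hom.comp
    (p.appTop.hom.comp (Scheme.ΓSpecIso (.of k)).inv.hom)

/-- The invertible sheaf `𝓞_X(E)` is very ample over `k`: there are a closed immersion `i` into some
`ℙⁿ` over `k` and an isomorphism `i^* 𝓞(1) ≃ 𝓞_X(E)`. Such an isomorphism is given by the images `s_j`
of the coordinate sections `X_j`; these are rational functions such that, at each point `x` with
`X_i ≠ 0` at `i(x)`, the function `s_i` generates `𝓞_X(E)_x` (that is, it is the inverse of a local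
equation of `E`), and `s_j = (X_j / X_i) s_i`. -/
def EffCartier.IsVeryAmple [IsIntegral X] (p : X ⟶ Spec (.of k)) (E : EffCartier X) : Prop :=
  ∃ (n : ℕ) (i : X ⟶ projSpace k n) (s : Fin (n + 1) → X.functionField),
    IsClosedImmersion i ∧ i ≫ projSpaceStr k n = p ∧
    ∀ (x : X) (a : Fin (n + 1)) (ha : i x ∈ stdOpen k n a),
      (∃ g : X.presheaf.stalk x, E.ideal x = Ideal.span {g} ∧
        algebraMap (X.presheaf.stalk x) X.functionField g * s a = 1) ∧
      ∀ b : Fin (n + 1),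
        s b = algebraMap (X.presheaf.stalk x) X.functionField
          ((i.stalkMap x).hom
            (((projSpace k n).presheaf.germ (stdOpen k n a) (i x) ha).hom (coordRatio k n b a))) *
          s a

/-- A divisor on a projective scheme is ample if some positive multiple of it is very ample. -/
def EffCartier.IsAmple [IsIntegral X] (p : X ⟶ Spec (.of k)) (E : EffCartier X) : Prop :=
  ∃ m : ℕ, 0 < m ∧ (E.mul m).IsVeryAmple p

end Projective

/-! ### Prime Weil divisors -/

section Weil

variable {X : Scheme.{u}}

/-- The generic point of an irreducible closed subset. -/
def gen (C : IrreducibleCloseds X) : X := C.isIrreducible.genericPoint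

lemma gen_specializes (C : IrreducibleCloseds X) {x : X} (hx : x ∈ C) : gen C ⤳ x := by
  have h := C.isIrreducible.isGenericPoint_genericPoint C.isClosed
  exact h.specializes hx

/-- The stalk at `x ∈ C` of the ideal sheaf of the reduced closed subscheme `C`: the germs whose
image in the local ring at the generic point of `C` is not invertible. -/
def curveIdeal (C : IrreducibleCloseds X) {x : X} (hx : x ∈ C) :
    Ideal (X.presheaf.stalk x) :=
  (IsLocalRing.maximalIdeal (X.presheaf.stalk (gen C))).comap
    (X.presheaf.stalkSpecializes (gen_specializes C hx)).hom

/-- The equality of Weil divisors `Z(E) = l C`, where `Z(E)` is the cycle of an effective Cartier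
divisor: the coefficient of `Z(E)` at the prime divisor with generic point `y` is the length of
`𝓞_{X,y} / 𝓞_X(-E)_y`. -/
def HasCycle (E : EffCartier X) (l : ℕ) (C : IrreducibleCloseds X) : Prop :=
  ∀ y : X, ringKrullDim (X.presheaf.stalk y) = 1 →
    (y = gen C → Module.length (X.presheaf.stalk y) (X.presheaf.stalk y ⧸ E.ideal y) = l) ∧
    (y ≠ gen C → Module.length (X.presheaf.stalk y) (X.presheaf.stalk y ⧸ E.ideal y) = 0)

/-- The prime Weil divisor `C` is an ample `ℚ`-Cartier divisor: it is not contained in the singular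
locus of `X`, and some positive multiple of it is the cycle of an ample effective Cartier
divisor. -/
def IsAmpleQCartier {k : Type u} [Field k] [IsIntegral X] (p : X ⟶ Spec (.of k))
    (C : IrreducibleCloseds X) : Prop :=
  IsRegularLocalRing (X.presheaf.stalk (gen C)) ∧
  ∃ l : ℕ, 0 < l ∧ ∃ E : EffCartier X, HasCycle E l C ∧ E.IsAmple p

end Weil

/-! ### Geometric data -/

/-- The power series ring `k[[u, t]]`. -/
abbrev PS (k : Type u) [Field k] : Type u := MvPowerSeries (Fin 2) k

/-- The variable `u` of `k[[u, t]]`. -/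
abbrev varU (k : Type u) [Field k] : PS k := MvPowerSeries.X 0

/-- The variable `t` of `k[[u, t]]`. -/
abbrev varT (k : Type u) [Field k] : PS k := MvPowerSeries.X 1

/-- The completed local ring `𝓞_{X,P}^`. -/
abbrev complStalk (X : Scheme.{u}) (P : X) : Type u :=
  AdicCompletion (IsLocalRing.maximalIdeal (X.presheaf.stalk P)) (X.presheaf.stalk P)

/-- The canonical homomorphism from the local ring at `P` to its completion. -/
def toCompl (X : Scheme.{u}) (P : X) : X.presheaf.stalk P →+* complStalk X P :=
  algebraMap (X.presheaf.stalk P) (complStalk X P)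

/-- A geometric data `(X, C, P, 𝓕, π, φ)` of rank `r` over the field `k`, together with the auxiliary
choices that occur in its definition: a local equation `f` of `C` at `P`, and the very ample Cartier
divisor `C' = dC` with `d` minimal. -/
structure GeometricData (k : Type u) [Field k] (r : ℕ) where
  /-- The surface. -/
  X : Scheme.{u}
  /-- Its structure morphism. -/
  str : X ⟶ Spec (.of k)
  [isIntegral : IsIntegral X]
  isProjective : IsProjective str
  dim_eq_two : topologicalKrullDim X = 2
  /-- The curve, a prime Weil divisor. -/
  C : IrreducibleCloseds X
  codim_eq_one : ringKrullDim (X.presheaf.stalk (gen C)) = 1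
  ample : IsAmpleQCartier str C
  /-- The point. -/
  P : X
  P_mem : P ∈ C
  P_closed : IsClosed ({P} : Set X)
  P_rational : Function.Bijective
    ((IsLocalRing.residue (X.presheaf.stalk P)).comp (scalar str P))
  P_regular : IsRegularLocalRing (X.presheaf.stalk P)
  P_regular_on_C : IsRegularLocalRing (X.presheaf.stalk P ⧸ curveIdeal C P_mem)
  /-- A local equation of `C` at `P`. -/
  f : X.presheaf.stalk P
  f_spec : Ideal.span {f} = curveIdeal C P_mem
  /-- The local homomorphism `π` of `k`-algebras. -/
  π : complStalk X P →+* PS k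
  π_scalar : ∀ c : k, π (toCompl X P (scalar str P c)) = MvPowerSeries.C c
  π_local : IsLocalHom π
  π_f : Ideal.span {π (toCompl X P f)} = Ideal.span {varT k ^ r}
  /-- The map `𝓞_P^ / (f) → k[[u, t]] / (t) = k[[u]]` induced by `π` is an isomorphism: it is
  surjective, and the kernel of the composite `𝓞_P^ → k[[u, t]] / (t)` is `(f)`. -/
  π_surjective : Function.Surjective ((Ideal.Quotient.mk (Ideal.span {varT k})).comp π)
  π_ker : RingHom.ker ((Ideal.Quotient.mk (Ideal.span {varT k})).comp π) =
    Ideal.span {toCompl X P f}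
  /-- The sheaf. -/
  F : X.Modules
  quasicoherent : F.IsQuasicoherent
  torsionFree : IsTorsionFree F
  /-- The minimal `d > 0` for which `dC` is a very ample Cartier divisor. -/
  d : ℕ
  d_isLeast : IsLeast {m : ℕ | 0 < m ∧ ∃ E : EffCartier X, HasCycle E m C ∧ E.IsVeryAmple str} d
  /-- The very ample Cartier divisor `C' = dC`. -/
  C' : EffCartier X
  C'_cycle : HasCycle C' d C
  C'_veryAmple : C'.IsVeryAmple str
  /-- The embedding `φ` of `𝓞_P`-modules. -/
  φ : mstalk F P →+ PS k
  φ_smul : ∀ (a : X.presheaf.stalk P) (m : mstalk F P), φ (a • m) = π (toCompl X P a) * φ m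
  φ_injective : Function.Injective φ
  /-- For every `n ≥ 0`, the composite of the embedding `H⁰(X, 𝓕(nC')) → 𝓕(nC')_P`, of the isomorphism
  `𝓕(nC')_P → 𝓕_P` given by multiplication by `f^(nd)`, of `φ`, and of the projection to
  `k[[u, t]] / (u, t)^(ndr + 1)` is an isomorphism. Here `ψ` is the composite of the first two; as
  `𝓕_P → 𝓕_η` is injective, it is determined by its property of being multiplication by `f^(nd)`. -/
  φ_iso : ∀ n : ℕ, ∃ ψ : twistSections F (C'.mul n) →+ mstalk F P,
    (∀ s : twistSections F (C'.mul n),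
      cosp F ((genericPoint_spec X).specializes (Set.mem_univ P)) (ψ s) =
        algebraMap (X.presheaf.stalk P) X.functionField (f ^ (n * d)) •
          (s : mstalk F (genericPoint X))) ∧
    Function.Bijective fun s =>
      Ideal.Quotient.mk (Ideal.span {varU k, varT k} ^ (n * d * r + 1)) (φ (ψ s))

end GeomData

end

/-! At a closed point Q of C, depth two comes down to this: every v in the generic stalk with 𝔪_Q v
⊆ 𝓕_Q lies in 𝓕_Q (`GeometricData.mem_stalkSub`). Suppose some v does not. As C' is very ample, a
function invertible at Q and a power of a coordinate section turn v into some s that is a section of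
𝓕(NC') away from Q, with 𝔪_Q s ⊆ 𝓕(NC')_Q but s ∉ 𝓕(NC')_Q (`exists_twisted_section`). Since C'
passes through Q, s is a global section of 𝓕((N+1)C').

The isomorphisms with truncated power series rings leave no room for s. Put z = f^(Nd) s. Then 𝔪_P z
⊆ 𝓕_P, and since t is prime in k[[u,t]], φ(fz) = π(f) w for some power series w
(`GeometricData.dvd_φ`). Surjectivity at level N gives s' ∈ H⁰(𝓕(NC')) with φ(f^(Nd) s') ≡ w modulo
(u,t)^(Ndr+1). Hence φ(f^((N+1)d) (s - s')) = π(f)^d (w - φ(f^(Nd) s')) lies in (u,t)^((N+1)dr+1),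
and injectivity at level N+1 forces s = s', a contradiction.

The rest is commutative algebra. Coherence makes the stalks finitely generated (`finite_mstalk`). A
nonzero g ∈ 𝔪_Q is regular by torsion-freeness, and 𝓕_Q/g𝓕_Q has zero socle, so prime avoidance
yields a second regular element; local rings of X have dimension at most 2. A non-closed point of C
is its generic point, where the dimension is 1 and one regular element suffices. At P, 𝓞_P/(f) is a
principal ideal domain and 𝓕_P/f𝓕_P is torsion free, hence free, and freeness lifts along the
regular element f. -/

noncomputable section

namespace GeomData

/-! ### Germs and cospecialization for sheaves of modules -/

section Sheaf

variable {X : Scheme.{u}}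

/-- The germ of a section of a sheaf of modules. -/
def mgerm (F : X.Modules) (U : X.Opens) (x : X) (hx : x ∈ U) : Γ(F, U) →+ mstalk F x :=
  (TopCat.Presheaf.germ F.presheaf U x hx).hom

lemma mgerm_smul (F : X.Modules) {U : X.Opens} {x : X} (hx : x ∈ U) (a : Γ(X, U)) (m : Γ(F, U)) :
    mgerm F U x hx (a • m) = X.presheaf.germ U x hx a • mgerm F U x hx m :=
  PresheafOfModules.germ_smul (R := X.presheaf) F.val x U hx a m

lemma exists_mgerm_eq (F : X.Modules) {x : X} (m : mstalk F x) :
    ∃ (U : X.Opens) (hx : x ∈ U) (σ : Γ(F, U)), mgerm F U x hx σ = m :=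
  TopCat.Presheaf.exists_germ_eq F.presheaf m

lemma mgerm_res (F : X.Modules) {U V : X.Opens} (h : V ≤ U) {x : X} (hx : x ∈ V) (σ : Γ(F, U)) :
    mgerm F V x hx (F.presheaf.map (homOfLE h).op σ) = mgerm F U x (h hx) σ :=
  TopCat.Presheaf.germ_res_apply F.presheaf (homOfLE h) x hx σ

lemma mgerm_eq_iff (F : X.Modules) {U : X.Opens} {x : X} (hx : x ∈ U) {σ : Γ(F, U)}
    (h : mgerm F U x hx σ = 0) :
    ∃ (V : X.Opens) (_ : x ∈ V) (hV : V ≤ U), F.presheaf.map (homOfLE hV).op σ = 0 := by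
  obtain ⟨W, hW, iU, iV, e⟩ := TopCat.Presheaf.germ_eq F.presheaf x hx hx σ 0
    (by rw [map_zero]; exact h)
  exact ⟨W, hW, iU.le, by rw [map_zero] at e; exact e⟩

lemma res_res (F : X.Modules) {U V W : X.Opens} (h : V ≤ U) (h' : W ≤ V) (σ : Γ(F, U)) :
    F.presheaf.map (homOfLE h').op (F.presheaf.map (homOfLE h).op σ) =
      F.presheaf.map (homOfLE (h'.trans h)).op σ := by
  rw [← ConcreteCategory.comp_apply, ← Functor.map_comp]
  rfl

lemma res_self (F : X.Modules) {U : X.Opens} (h : U ≤ U) (σ : Γ(F, U)) :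
    F.presheaf.map (homOfLE h).op σ = σ := by
  change F.presheaf.map (𝟙 _) σ = σ
  rw [F.presheaf.map_id]
  rfl

lemma presheaf_res_res {U V W : X.Opens} (h : V ≤ U) (h' : W ≤ V) (a : Γ(X, U)) :
    X.presheaf.map (homOfLE h').op (X.presheaf.map (homOfLE h).op a) =
      X.presheaf.map (homOfLE (h'.trans h)).op a := by
  rw [← ConcreteCategory.comp_apply, ← Functor.map_comp]
  rfl

lemma presheaf_res_self {U : X.Opens} (h : U ≤ U) (a : Γ(X, U)) :
    X.presheaf.map (homOfLE h).op a = a := by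
  change X.presheaf.map (𝟙 _) a = a
  rw [X.presheaf.map_id]
  rfl

lemma cosp_mgerm (F : X.Modules) {U : X.Opens} {x y : X} (h : y ⤳ x) (hx : x ∈ U) (σ : Γ(F, U)) :
    cosp F h (mgerm F U x hx σ) = mgerm F U y (h.mem_open U.2 hx) σ :=
  TopCat.Presheaf.germ_stalkSpecializes_apply F.presheaf hx h σ

lemma cosp_smul (F : X.Modules) {x y : X} (h : y ⤳ x) (a : X.presheaf.stalk x) (m : mstalk F x) :
    cosp F h (a • m) = (X.presheaf.stalkSpecializes h).hom a • cosp F h m := by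
  obtain ⟨U, hU, a, rfl⟩ := X.presheaf.exists_germ_eq a
  obtain ⟨V, hV, m, rfl⟩ := exists_mgerm_eq F m
  have hW : x ∈ U ⊓ V := ⟨hU, hV⟩
  rw [← mgerm_res F inf_le_right hW, ← X.presheaf.germ_res_apply (homOfLE inf_le_left) x hW a,
    ← mgerm_smul, cosp_mgerm, cosp_mgerm, mgerm_smul]
  congr 1
  exact (X.presheaf.germ_stalkSpecializes_apply hW h _).symm

end Sheaf

/-! ### Quasi-coherent sheaves on affine opens: clearing denominators -/

section QCoh

variable {R : CommRingCat.{u}}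

/-- The basic open subset of a spectrum. -/
abbrev specBasicOpen (f : R) : (Spec R).Opens := PrimeSpectrum.basicOpen f

lemma isLocalizedModule_res_specBasicOpen (M : (Spec R).Modules) [M.IsQuasicoherent] (f : R) :
    IsLocalizedModule (.powers f)
      ((modulesSpecToSheaf.obj M).obj.map (specBasicOpen f).leTop.op).hom :=
  (isIso_fromTildeΓ_iff_isLocalizing M).1 inferInstance f

lemma exists_res_eq_pow_smul (M : (Spec R).Modules) [M.IsQuasicoherent] (f : R)
    (τ : Γ(M, specBasicOpen f)) :
    ∃ (n : ℕ) (σ : Γ(M, ⊤)), M.presheaf.map (homOfLE le_top).op σ = f ^ n • τ := by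
  have := isLocalizedModule_res_specBasicOpen M f
  obtain ⟨⟨σ, ⟨_, n, rfl⟩⟩, h⟩ := IsLocalizedModule.surj (.powers f)
    ((modulesSpecToSheaf.obj M).obj.map (specBasicOpen f).leTop.op).hom τ
  exact ⟨n, σ, h.symm⟩

lemma exists_pow_smul_eq_zero (M : (Spec R).Modules) [M.IsQuasicoherent] (f : R) (σ : Γ(M, ⊤))
    (h : M.presheaf.map (homOfLE (le_top : specBasicOpen f ≤ ⊤)).op σ = 0) :
    ∃ n : ℕ, f ^ n • σ = 0 := by
  have := isLocalizedModule_res_specBasicOpen M f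
  obtain ⟨⟨_, n, rfl⟩, h⟩ := (IsLocalizedModule.eq_zero_iff (.powers f)
    ((modulesSpecToSheaf.obj M).obj.map (specBasicOpen f).leTop.op).hom).1 h
  exact ⟨n, h⟩

end QCoh

section Affine

variable {X : Scheme.{u}} (F : X.Modules) {U : X.Opens} (hU : IsAffineOpen U)

lemma fromSpec_image_le (V : (Spec Γ(X, U)).Opens) : hU.fromSpec ''ᵁ V ≤ U := by
  exact (hU.fromSpec.image_le_opensRange V).trans hU.opensRange_fromSpec.le

lemma fromSpec_image_mono {V W : (Spec Γ(X, U)).Opens} (h : V ≤ W) :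
    hU.fromSpec ''ᵁ V ≤ hU.fromSpec ''ᵁ W :=
  Scheme.Hom.image_mono _ h

lemma fromSpec_appIso_inv (V : (Spec Γ(X, U)).Opens) (b : Γ(X, U)) :
    (hU.fromSpec.appIso V).inv
        ((Spec Γ(X, U)).presheaf.map V.leTop.op ((Scheme.ΓSpecIso Γ(X, U)).inv b)) =
      X.presheaf.map (homOfLE (fromSpec_image_le hU V)).op b := by
  have h : X.presheaf.map (homOfLE (fromSpec_image_le hU V)).op ≫ (hU.fromSpec.appIso V).hom =
      (Scheme.ΓSpecIso Γ(X, U)).inv ≫ (Spec Γ(X, U)).presheaf.map V.leTop.op := by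
    rw [Scheme.Hom.appIso_hom', Scheme.Hom.map_appLE, Scheme.Hom.appLE, hU.fromSpec_app_self,
      Category.assoc, ← Functor.map_comp]
    rfl
  have h' := congr($h b)
  simp only [ConcreteCategory.comp_apply] at h'
  rw [← h', ← ConcreteCategory.comp_apply, Iso.hom_inv_id]
  rfl

lemma restrict_fromSpec_smul (V : (Spec Γ(X, U)).Opens) (b : Γ(X, U))
    (σ : Γ(F.restrict hU.fromSpec, V)) :
    (F.restrictAppIso hU.fromSpec V).hom (b • σ) =
      (X.presheaf.map (homOfLE (fromSpec_image_le hU V)).op b : Γ(X, hU.fromSpec ''ᵁ V)) •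
        (F.restrictAppIso hU.fromSpec V).hom σ := by
  rw [← fromSpec_appIso_inv]
  rfl

include hU in
lemma exists_res_basicOpen_eq [F.IsQuasicoherent] (b : Γ(X, U)) (τ : Γ(F, X.basicOpen b)) :
    ∃ (n : ℕ) (σ : Γ(F, U)), F.presheaf.map (homOfLE (X.basicOpen_le b)).op σ =
      (X.presheaf.map (homOfLE (X.basicOpen_le b)).op (b ^ n)) • τ := by
  have e : hU.fromSpec ''ᵁ (specBasicOpen b) = X.basicOpen b := hU.fromSpec_image_basicOpen b
  have e' : hU.fromSpec ''ᵁ ⊤ = U := by simp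
  obtain ⟨n, σ, h⟩ := exists_res_eq_pow_smul (F.restrict hU.fromSpec) b
    ((F.restrictAppIso hU.fromSpec _).inv (F.presheaf.map (homOfLE e.le).op τ))
  refine ⟨n, F.presheaf.map (homOfLE e'.ge).op ((F.restrictAppIso hU.fromSpec _).hom σ), ?_⟩
  have h' := congr(F.presheaf.map (homOfLE e.ge).op ((F.restrictAppIso hU.fromSpec _).hom $h))
  rw [restrict_fromSpec_smul, Scheme.Modules.map_smul] at h'
  rw [presheaf_res_res] at h'
  refine Eq.trans ?_ (h'.trans ?_)
  · refine (res_res F _ _ _).trans ?_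
    symm
    exact res_res F (fromSpec_image_mono hU le_top) e.ge ((F.restrictAppIso hU.fromSpec ⊤).hom σ)
  · congr 1
    exact (res_res F _ _ τ).trans (res_self F _ τ)

include hU in
lemma exists_pow_smul_eq_zero_of_res [F.IsQuasicoherent] (b : Γ(X, U)) (σ : Γ(F, U))
    (h : F.presheaf.map (homOfLE (X.basicOpen_le b)).op σ = 0) :
    ∃ n : ℕ, b ^ n • σ = 0 := by
  have e : hU.fromSpec ''ᵁ (specBasicOpen b) = X.basicOpen b := hU.fromSpec_image_basicOpen b
  have e' : hU.fromSpec ''ᵁ ⊤ = U := by simp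
  obtain ⟨n, h⟩ := exists_pow_smul_eq_zero (F.restrict hU.fromSpec) b
    ((F.restrictAppIso hU.fromSpec _).inv (F.presheaf.map (homOfLE e'.le).op σ)) (by
      have h' := congr((F.restrictAppIso hU.fromSpec _).inv (F.presheaf.map (homOfLE e.le).op $h))
      rw [map_zero, map_zero] at h'
      rw [← h', res_res]
      exact res_res F e'.le (fromSpec_image_mono hU le_top) σ)
  refine ⟨n, ?_⟩
  have h' := congr(F.presheaf.map (homOfLE e'.ge).op ((F.restrictAppIso hU.fromSpec _).hom $h))
  rw [restrict_fromSpec_smul, Scheme.Modules.map_smul, map_zero, map_zero] at h'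
  rw [presheaf_res_res, presheaf_res_self] at h'
  rw [← h']
  congr 1
  exact ((res_res F _ _ σ).trans (res_self F _ σ)).symm

include hU in
lemma exists_smul_eq_mgerm [F.IsQuasicoherent] {y : X} (hy : y ∈ U) (m : mstalk F y) :
    ∃ (b : Γ(X, U)) (_ : y ∈ X.basicOpen b) (σ : Γ(F, U)),
      X.presheaf.germ U y hy b • m = mgerm F U y hy σ := by
  obtain ⟨W, hW, τ, rfl⟩ := exists_mgerm_eq F m
  obtain ⟨b, hb, hyb⟩ := hU.exists_basicOpen_le ⟨y, hW⟩ hy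
  obtain ⟨n, σ, h⟩ := exists_res_basicOpen_eq F hU b (F.presheaf.map (homOfLE hb).op τ)
  -- The extra factor b keeps the exponent positive, so that D(b^(n+1)) = D(b) even for n = 0.
  refine ⟨b ^ (n + 1), ?_, b • σ, ?_⟩
  · rwa [X.basicOpen_pow _ n.succ_pos]
  · have h' := congr(mgerm F _ y hyb $h)
    rw [mgerm_res, mgerm_smul, mgerm_res, X.presheaf.germ_res_apply] at h'
    rw [mgerm_smul, h', pow_succ', map_mul, mul_smul]

include hU in
lemma exists_smul_eq_zero_of_mgerm_eq_zero [F.IsQuasicoherent] {y : X} (hy : y ∈ U) (σ : Γ(F, U))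
    (h : mgerm F U y hy σ = 0) :
    ∃ (b : Γ(X, U)) (_ : y ∈ X.basicOpen b), b • σ = 0 := by
  obtain ⟨W, hyW, hW, h⟩ := mgerm_eq_iff F hy h
  obtain ⟨b, hb, hyb⟩ := hU.exists_basicOpen_le ⟨y, hyW⟩ hy
  obtain ⟨n, h⟩ := exists_pow_smul_eq_zero_of_res F hU b σ (by
    have h' := congr(F.presheaf.map (homOfLE hb).op $h)
    rw [map_zero] at h'
    rw [← h', res_res])
  refine ⟨b ^ (n + 1), ?_, ?_⟩
  · rwa [X.basicOpen_pow _ n.succ_pos]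
  · rw [pow_succ', mul_smul, h, smul_zero]

end Affine

/-! ### Finite generation of the stalks of a coherent sheaf -/

section FiniteType

open Scheme.Modules

/-- Generating sections are an epimorphism from a free sheaf. Between tilde sheaves it comes from a
module map because tilde is full, and that map is surjective because tilde reflects epimorphisms. -/
lemma finite_of_generatingSections {R : CommRingCat.{u}} (M : (Spec R).Modules) [M.IsQuasicoherent]
    (σ : SheafOfModules.GeneratingSections.{u} M) [σ.IsFiniteType] : Module.Finite R Γ(M, ⊤) := by
  have : Finite σ.I := SheafOfModules.GeneratingSections.IsFiniteType.finite
  have : IsIso M.fromTildeΓ := isIso_fromTildeΓ_of_isQuasicoherent M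
  let N : ModuleCat R := (modulesSpecToSheaf.obj M).presheaf.obj (.op ⊤)
  let p : tilde (ModuleCat.of R (σ.I →₀ R)) ⟶ tilde N :=
    (tildeFinsupp σ.I).hom ≫ σ.π ≫ (asIso M.fromTildeΓ).inv
  have hp : Epi p := by
    have h1 := σ.epi
    have h2 {C : Type (u+1)} [Category.{u} C] {A B : C} (e : A ≅ B) : Epi e.hom := inferInstance
    have h3 := h2 (asIso M.fromTildeΓ).symm
    have h4 := @epi_comp _ _ _ _ _ σ.π h1 (asIso M.fromTildeΓ).inv h3
    exact @epi_comp _ _ _ _ _ (tildeFinsupp σ.I).hom (h2 _) _ h4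
  obtain ⟨g, hg⟩ := (tilde.functor R).map_surjective p
  have : Epi g := (tilde.functor R).epi_of_epi_map (by rw [hg]; exact hp)
  have hs := (ModuleCat.epi_iff_surjective g).1 this
  exact Module.Finite.of_surjective (M := σ.I →₀ R) (P := N) g.hom hs

lemma exists_generatingSections_map {X Y : Scheme.{u}} {W : X.Opens}
    (G : SheafOfModules.{u} (X.ringCatSheaf.over W) ⥤ SheafOfModules.{u} Y.ringCatSheaf)
    (hG : Limits.PreservesColimitsOfSize.{u, u} G)
    (η : SheafOfModules.unit _ ≅ G.obj (SheafOfModules.unit _))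
    {M : SheafOfModules.{u} (X.ringCatSheaf.over W)} {N : SheafOfModules.{u} Y.ringCatSheaf}
    (τ : SheafOfModules.GeneratingSections.{u} M) (hτ : τ.IsFiniteType) (e : G.obj M ≅ N) :
    ∃ σ : SheafOfModules.GeneratingSections.{u} N, σ.IsFiniteType :=
  ⟨(τ.map G η).ofEpi e.hom, inferInstance⟩

/-- Modules over the slice of W are modules on the open subscheme W. Restricting these to the
spectrum of Γ(X, U) preserves colimits and the unit, so it carries generators to generators. -/
lemma exists_generatingSections_of_over {X : Scheme.{u}} (F : X.Modules) (W : X.Opens)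
    (τ : SheafOfModules.GeneratingSections.{u} (SheafOfModules.over F W)) [hτ : τ.IsFiniteType]
    {U : X.Opens} (hU : IsAffineOpen U) (hUW : U ≤ W) :
    ∃ σ : SheafOfModules.GeneratingSections.{u} (F.restrict hU.fromSpec), σ.IsFiniteType := by
  let u : Spec Γ(X, U) ⟶ W := hU.isoSpec.inv ≫ X.homOfLE hUW
  have hcomp : u ≫ W.ι = hU.fromSpec := by
    rw [← hU.isoSpec_inv_ι, Category.assoc, X.homOfLE_ι]
  have : Limits.PreservesColimitsOfSize.{u, u} (restrictFunctor u) := inferInstance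
  let G := (overEquiv W).functor ⋙ restrictFunctor u
  have : Limits.PreservesColimitsOfSize.{u, u} G :=
    Limits.comp_preservesColimits (overEquiv W).functor (restrictFunctor u)
  let iso : SheafOfModules.overFunctor X.ringCatSheaf _ ⋙ G ≅ restrictFunctor hU.fromSpec :=
    (Functor.associator _ _ _).symm ≪≫
      Functor.isoWhiskerRight (Scheme.Modules.overFunctorEquiv _) _ ≪≫
      (restrictFunctorComp _ _).symm ≪≫ (restrictFunctorCongr hcomp)
  exact exists_generatingSections_map G this (restrictUnitIso _).symm τ hτ (iso.app F)

lemma exists_generatingSections {X : Scheme.{u}} (F : X.Modules) [F.IsFiniteType] (x : X) :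
    ∃ (U : X.Opens) (_ : x ∈ U) (hU : IsAffineOpen U)
      (σ : SheafOfModules.GeneratingSections.{u} (F.restrict hU.fromSpec)), σ.IsFiniteType := by
  obtain ⟨⟨I, W, cov, gens⟩, hfin⟩ :=
    SheafOfModules.IsFiniteType.exists_localGeneratorsData (M := F)
  rw [Opens.coversTop_iff] at cov
  obtain ⟨i, hi⟩ : ∃ i, x ∈ W i := by
    have : x ∈ (⨆ i, W i) := cov ▸ trivial
    simpa using this
  obtain ⟨_, ⟨U, hU, rfl⟩, hxU, hUW⟩ := X.isBasis_affineOpens.exists_subset_of_mem_open hi (W i).2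
  have := hfin.isFiniteType i
  exact ⟨U, hxU, hU, exists_generatingSections_of_over F (W i) (gens i) (hτ := this) hU hUW⟩

/-- On an affine neighbourhood every germ is, up to a unit of the local ring, the germ of a section
over the whole neighbourhood; hence generators of the sections generate the stalk. -/
lemma finite_mstalk {X : Scheme.{u}} (F : X.Modules) [F.IsQuasicoherent] [F.IsFiniteType] (x : X) :
    Module.Finite (X.presheaf.stalk x) (mstalk F x) := by
  obtain ⟨U, hx, hU, σ, hσ⟩ := exists_generatingSections F x
  have hfin := finite_of_generatingSections _ σ
  have e' : hU.fromSpec ''ᵁ ⊤ = U := by simp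
  obtain ⟨s, hs⟩ := hfin.fg_top
  let γ : Γ(F.restrict hU.fromSpec, ⊤) → mstalk F x := fun τ ↦
    mgerm F U x hx (F.presheaf.map (homOfLE e'.ge).op ((F.restrictAppIso hU.fromSpec _).hom τ))
  have γ_add (τ τ') : γ (τ + τ') = γ τ + γ τ' := by simp only [γ, map_add]
  have γ_zero : γ 0 = 0 := by simp only [γ, map_zero]
  have γ_smul (b : Γ(X, U)) (τ) : γ (b • τ) = X.presheaf.germ U x hx b • γ τ := by
    simp only [γ]
    rw [restrict_fromSpec_smul, Scheme.Modules.map_smul, mgerm_smul, presheaf_res_res,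
      presheaf_res_self]
  classical
  refine ⟨⟨s.image γ, ?_⟩⟩
  rw [eq_top_iff]
  rintro m -
  obtain ⟨b, hb, τ, h⟩ := exists_smul_eq_mgerm F hU hx m
  have key (τ) : γ τ ∈ Submodule.span (X.presheaf.stalk x) (s.image γ : Set (mstalk F x)) := by
    have hτ : τ ∈ Submodule.span Γ(X, U) (s : Set Γ(F.restrict hU.fromSpec, ⊤)) := hs ▸ trivial
    induction hτ using Submodule.span_induction with
    | mem y hy => exact Submodule.subset_span (by simpa using ⟨y, hy, rfl⟩)
    | zero => rw [γ_zero]; exact zero_mem _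
    | add y z _ _ hy hz => rw [γ_add]; exact add_mem hy hz
    | smul a y _ hy => rw [γ_smul]; exact Submodule.smul_mem _ _ hy
  have hu : IsUnit (X.presheaf.germ U x hx b) := (X.mem_basicOpen b x hx).1 hb
  rw [← Submodule.smul_mem_iff_of_isUnit _ hu, h]
  convert key ((F.restrictAppIso hU.fromSpec _).inv (F.presheaf.map (homOfLE e'.le).op τ))
  exact ((res_res F _ _ τ).trans (res_self F _ τ)).symm

end FiniteType

/-! ### Projective space: Noetherianity and the standard charts -/

section ProjectiveSpace

variable (k : Type u) [Field k] (n : ℕ)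

lemma isNoetherianRing_grading_zero : IsNoetherianRing (grading k n 0) := by
  refine isNoetherianRing_of_surjective k _ (algebraMap k (grading k n 0)) fun x ↦ ?_
  obtain ⟨x, hx⟩ := x
  have hx' := MvPolynomial.totalDegree_eq_zero_iff_eq_C.1
    (Nat.le_zero.1 (((MvPolynomial.mem_homogeneousSubmodule 0 x).1 hx).totalDegree_le))
  exact ⟨_, Subtype.ext hx'.symm⟩

instance finiteType_grading_zero :
    Algebra.FiniteType (grading k n 0) (MvPolynomial (Fin (n + 1)) k) :=
  have : IsScalarTower k (grading k n 0) (MvPolynomial (Fin (n + 1)) k) :=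
    ⟨fun c x y ↦ by
      change (c • (x : MvPolynomial (Fin (n + 1)) k)) * y = c • ((x : MvPolynomial _ k) * y)
      rw [smul_mul_assoc]⟩
  Algebra.FiniteType.of_restrictScalars_finiteType k _ _

instance isLocallyNoetherian_projSpace : IsLocallyNoetherian (projSpace k n) := by
  have := isNoetherianRing_grading_zero k n
  have : IsLocallyNoetherian (Spec (.of (grading k n 0))) := inferInstance
  exact LocallyOfFiniteType.isLocallyNoetherian (Proj.toSpecZero (grading k n))

lemma iSup_stdOpen : ⨆ a, stdOpen k n a = ⊤ := by
  refine Proj.iSup_basicOpen_eq_top' _ _ (fun a ↦ ⟨1, MvPolynomial.isHomogeneous_X k a⟩) ?_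
  rw [eq_top_iff]
  rintro x -
  induction x using MvPolynomial.induction_on with
  | C c =>
    exact Subalgebra.algebraMap_mem _
      (⟨MvPolynomial.C c, MvPolynomial.isHomogeneous_C _ c⟩ : grading k n 0)
  | add p q hp hq => exact add_mem hp hq
  | mul_X p a hp => exact mul_mem hp (Algebra.subset_adjoin ⟨a, rfl⟩)

variable {k n}

/-- A fraction in the local ring at z is a unit only if its numerator avoids the homogeneous prime
of z. This places the locus in chart c where X_a / X_c is invertible inside chart a. -/
lemma mem_stdOpen_of_isUnit_germ {a c : Fin (n + 1)} {z : projSpace k n} (hz : z ∈ stdOpen k n c)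
    (h : IsUnit ((projSpace k n).presheaf.germ (stdOpen k n c) z hz (coordRatio k n a c))) :
    z ∈ stdOpen k n a := by
  have h1 := h.map (Proj.stalkIso' (grading k n) z)
  have e := Proj.stalkIso'_germ (𝒜 := grading k n) (stdOpen k n c) z hz (coordRatio k n a c)
  have h2 : IsUnit ((coordRatio k n a c).1 ⟨z, hz⟩) := e ▸ h1
  rw [← HomogeneousLocalization.isUnit_iff_isUnit_val] at h2
  have e2 := ProjectiveSpectrum.Proj.awayToSection_apply (grading k n) (MvPolynomial.X c)
    (HomogeneousLocalization.Away.mk (grading k n) (d := 1)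
      (MvPolynomial.isHomogeneous_X k c) 1 (MvPolynomial.X a)
      (by simpa using MvPolynomial.isHomogeneous_X k a)) ⟨z, hz⟩
  have e3 := (e2.trans (congrArg _ ((HomogeneousLocalization.Away.val_mk _ _ _ _ _).trans
    (Localization.mk_eq_mk'_apply _ _)))).trans (IsLocalization.map_mk' _ _ _)
  have : z.asHomogeneousIdeal.toIdeal.IsPrime := ProjectiveSpectrum.isPrime z
  exact (IsLocalization.AtPrime.isUnit_mk'_iff _ z.1.toIdeal _ _).1 ((congrArg IsUnit e3).mp h2)

end ProjectiveSpace

section Projective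

variable {k : Type u} [Field k] {X : Scheme.{u}}

lemma IsProjective.isLocallyNoetherian {p : X ⟶ Spec (.of k)} (h : IsProjective p) :
    IsLocallyNoetherian X := by
  obtain ⟨n, i, hi, -⟩ := h
  exact LocallyOfFiniteType.isLocallyNoetherian i

end Projective

/-! ### Functions vanishing at a closed point -/

section Vanishing

variable {X : Scheme.{u}}

/-- An affine open neighbourhood separates a point from a different closed point. -/
lemma exists_mem_basicOpen_notMem {U : X.Opens} (hU : IsAffineOpen U) {Q y : X}
    (hQ : IsClosed ({Q} : Set X)) (hy : y ∈ U) (hyQ : y ≠ Q) :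
    ∃ q : Γ(X, U), y ∈ X.basicOpen q ∧ Q ∉ X.basicOpen q := by
  obtain ⟨q, hq, hyq⟩ := hU.exists_basicOpen_le (V := ⟨{Q}ᶜ, hQ.isOpen_compl⟩) ⟨y, hyQ⟩ hy
  exact ⟨q, hyq, fun h ↦ hq h rfl⟩

/-- The ideal of the regular functions on `U` that vanish at `Q`. -/
def vanIdeal (U : X.Opens) (Q : X) : Ideal Γ(X, U) :=
  ⨅ h : Q ∈ U, (IsLocalRing.maximalIdeal (X.presheaf.stalk Q)).comap (X.presheaf.germ U Q h).hom

/-- For Q ∉ U the infimum is empty and the ideal is the whole ring, so charts that miss Q need no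
separate treatment. -/
lemma mem_vanIdeal {U : X.Opens} {Q : X} {q : Γ(X, U)} :
    q ∈ vanIdeal U Q ↔ Q ∉ X.basicOpen q := by
  simp only [vanIdeal, Ideal.mem_iInf, Ideal.mem_comap, IsLocalRing.mem_maximalIdeal,
    mem_nonunits_iff]
  constructor
  · intro h hQ
    exact h (X.basicOpen_le q hQ) ((X.mem_basicOpen q Q _).1 hQ)
  · intro h hQ hu
    exact h ((X.mem_basicOpen q Q hQ).2 hu)

end Vanishing

/-! ### Stalks inside the generic stalk, and ideals of denominators -/

section StalkSubgroups

variable {X : Scheme.{u}} [IsIntegral X] (F : X.Modules)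

lemma genericPoint_specializes' (x : X) : genericPoint X ⤳ x :=
  (genericPoint_spec X).specializes (Set.mem_univ x)

lemma genericPoint_mem {U : X.Opens} {x : X} (hx : x ∈ U) : genericPoint X ∈ U :=
  (genericPoint_specializes' x).mem_open U.2 hx

/-- The stalk `𝓕_x` as a subgroup of the generic stalk. -/
def stalkSub (x : X) : AddSubgroup (mstalk F (genericPoint X)) :=
  (cosp F (genericPoint_specializes' x)).range

variable {F}

lemma smul_mem_stalkSub {x : X} (a : X.presheaf.stalk x) {v : mstalk F (genericPoint X)}
    (hv : v ∈ stalkSub F x) :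
    algebraMap (X.presheaf.stalk x) X.functionField a • v ∈ stalkSub F x := by
  obtain ⟨m, rfl⟩ := hv
  exact ⟨a • m, cosp_smul F _ a m⟩

lemma smul_mem_stalkSub_iff {x : X} {a : X.presheaf.stalk x} (ha : IsUnit a)
    {v : mstalk F (genericPoint X)} :
    algebraMap (X.presheaf.stalk x) X.functionField a • v ∈ stalkSub F x ↔ v ∈ stalkSub F x := by
  refine ⟨fun h ↦ ?_, smul_mem_stalkSub a⟩
  obtain ⟨b, hb⟩ := ha.exists_left_inv
  have := smul_mem_stalkSub b h
  rwa [smul_smul, ← map_mul, hb, map_one, one_smul] at this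

/-- The restriction of a regular function on `U` to the generic point. -/
def toK (U : X.Opens) {x : X} (hx : x ∈ U) : Γ(X, U) →+* X.functionField :=
  (X.presheaf.germ U (genericPoint X) (genericPoint_mem hx)).hom

lemma algebraMap_germ (U : X.Opens) {x y : X} (hx : x ∈ U) (hy : y ∈ U) (a : Γ(X, U)) :
    algebraMap (X.presheaf.stalk y) X.functionField (X.presheaf.germ U y hy a) = toK U hx a :=
  X.presheaf.germ_stalkSpecializes_apply hy (genericPoint_specializes' y) a

variable (F) in
/-- The group of sections over `U` as a subgroup of the generic stalk. -/
def secSub (U : X.Opens) {x : X} (hx : x ∈ U) : AddSubgroup (mstalk F (genericPoint X)) :=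
  (mgerm F U (genericPoint X) (genericPoint_mem hx)).range

lemma smul_mem_secSub {U : X.Opens} {x : X} (hx : x ∈ U) (a : Γ(X, U))
    {v : mstalk F (genericPoint X)} (hv : v ∈ secSub F U hx) : toK U hx a • v ∈ secSub F U hx := by
  obtain ⟨σ, rfl⟩ := hv
  exact ⟨a • σ, mgerm_smul F _ a σ⟩

lemma mem_stalkSub_of_mem_secSub {U : X.Opens} {x y : X} (hx : x ∈ U) (hy : y ∈ U)
    {v : mstalk F (genericPoint X)} (hv : v ∈ secSub F U hx) : v ∈ stalkSub F y := by
  obtain ⟨σ, rfl⟩ := hv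
  exact ⟨mgerm F U y hy σ, cosp_mgerm F _ hy σ⟩

lemma exists_smul_mem_secSub [F.IsQuasicoherent] {U : X.Opens} (hU : IsAffineOpen U) {x y : X}
    (hx : x ∈ U) (hy : y ∈ U) {v : mstalk F (genericPoint X)} (hv : v ∈ stalkSub F y) :
    ∃ b : Γ(X, U), y ∈ X.basicOpen b ∧ toK U hx b • v ∈ secSub F U hx := by
  obtain ⟨m, rfl⟩ := hv
  obtain ⟨b, hb, σ, h⟩ := exists_smul_eq_mgerm F hU hy m
  refine ⟨b, hb, σ, ?_⟩
  rw [← algebraMap_germ U hx hy, ← cosp_mgerm F (genericPoint_specializes' y) hy, ← h]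
  exact cosp_smul F _ _ m

/-- On a torsion free quasi-coherent sheaf, the map from a stalk to the generic stalk is
injective. -/
lemma cosp_injective [F.IsQuasicoherent] (hF : IsTorsionFree F) (x : X) :
    Function.Injective (cosp F (genericPoint_specializes' x)) := by
  rw [injective_iff_map_eq_zero]
  intro m hm
  obtain ⟨_, ⟨U, hU, rfl⟩, hxU, -⟩ :=
    X.isBasis_affineOpens.exists_subset_of_mem_open (Set.mem_univ x) isOpen_univ
  obtain ⟨b, hb, σ, h⟩ := exists_smul_eq_mgerm F hU hxU m
  have h0 : mgerm F U (genericPoint X) (genericPoint_mem hxU) σ = 0 := by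
    rw [← cosp_mgerm F (genericPoint_specializes' x) hxU, ← h, cosp_smul, hm, smul_zero]
  obtain ⟨c, hc, h1⟩ := exists_smul_eq_zero_of_mgerm_eq_zero F hU _ σ h0
  -- The function c is invertible at the generic point, so its germ at x is nonzero and
  -- torsion-freeness applies.
  have hc0 : X.presheaf.germ U x hxU c ≠ 0 := by
    intro h2
    have h3 := (X.mem_basicOpen c _ (genericPoint_mem hxU)).1 hc
    have h4 := algebraMap_germ U hxU hxU c
    rw [h2, map_zero] at h4
    exact h3.ne_zero h4.symm
  have hu : IsUnit (X.presheaf.germ U x hxU b) := (X.mem_basicOpen b x hxU).1 hb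
  have := hF x
  have h2 : X.presheaf.germ U x hxU c • X.presheaf.germ U x hxU b • m = 0 := by
    rw [h, ← mgerm_smul, h1, map_zero]
  exact hu.smul_eq_zero.1 ((smul_eq_zero.1 h2).resolve_left hc0)

/-- The ideal of denominators of an element of the generic stalk. -/
def denIdeal (F : X.Modules) (U : X.Opens) {x : X} (hx : x ∈ U) (v : mstalk F (genericPoint X)) :
    Ideal Γ(X, U) where
  carrier := {a | toK U hx a • v ∈ secSub F U hx}
  zero_mem' := by
    change toK U hx 0 • v ∈ secSub F U hx
    rw [map_zero, zero_smul]; exact zero_mem _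
  add_mem' {a b} ha hb := by
    change toK U hx (a + b) • v ∈ secSub F U hx
    rw [map_add, add_smul]; exact add_mem ha hb
  smul_mem' a b hb := by
    change toK U hx (a * b) • v ∈ secSub F U hx
    rw [map_mul, mul_smul]; exact smul_mem_secSub hx a hb

/-- If `𝔪_Q v ⊆ 𝓕_Q` then, after multiplication by a function on `U` that does not vanish at `Q`,
all functions that vanish at `Q` multiply `v` into the sections over `U`. -/
lemma exists_vanIdeal_le_denIdeal [F.IsQuasicoherent] {U : X.Opens} (hU : IsAffineOpen U)
    [IsNoetherianRing Γ(X, U)] {Q : X} (hQ : Q ∈ U) {v : mstalk F (genericPoint X)}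
    (hv : ∀ a ∈ IsLocalRing.maximalIdeal (X.presheaf.stalk Q),
      algebraMap (X.presheaf.stalk Q) X.functionField a • v ∈ stalkSub F Q) :
    ∃ b : Γ(X, U), Q ∈ X.basicOpen b ∧ vanIdeal U Q ≤ denIdeal F U hQ (toK U hQ b • v) := by
  obtain ⟨s, hs⟩ := (isNoetherianRing_iff_ideal_fg _).1 ‹_› (vanIdeal U Q)
  have h (q : s) : ∃ b : Γ(X, U), Q ∈ X.basicOpen b ∧
      toK U hQ b • toK U hQ q.1 • v ∈ secSub F U hQ := by
    refine exists_smul_mem_secSub hU hQ hQ ?_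
    have hq : q.1 ∈ vanIdeal U Q := hs ▸ Submodule.subset_span q.2
    rw [← algebraMap_germ U hQ hQ]
    exact hv _ (by simpa [vanIdeal, hQ] using hq)
  choose b hb hbv using h
  classical
  -- One denominator for each of finitely many generators of the vanishing ideal; their product
  -- serves all of them.
  refine ⟨∏ q, b q, ?_, ?_⟩
  · rw [X.mem_basicOpen _ Q hQ, map_prod]
    exact IsUnit.prod_univ_iff.2 fun q ↦ (X.mem_basicOpen _ Q hQ).1 (hb q)
  · rw [← hs, Submodule.span_le]
    intro q hq
    change toK U hQ q • toK U hQ (∏ q, b q) • v ∈ secSub F U hQ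
    rw [← Finset.mul_prod_erase _ _ (Finset.mem_univ (⟨q, hq⟩ : s)), map_mul, smul_smul,
      mul_comm, mul_assoc, mul_left_comm, mul_smul, mul_smul]
    exact smul_mem_secSub hQ _ (hbv ⟨q, hq⟩)

/-- If `v` is a section of `𝓕` over `D(e) ∖ {Q}`, then a power of `𝔮 e` multiplies `v` into the
sections over `U`, where `𝔮` is the ideal of `Q`. -/
lemma exists_pow_le_denIdeal [F.IsQuasicoherent] {U : X.Opens} (hU : IsAffineOpen U)
    [IsNoetherianRing Γ(X, U)] {x : X} (hx : x ∈ U) (Q : X) {v : mstalk F (genericPoint X)}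
    (e : Γ(X, U)) (hv : ∀ y ∈ X.basicOpen e, y ≠ Q → v ∈ stalkSub F y) :
    ∃ N : ℕ, (vanIdeal U Q * Ideal.span {e}) ^ N ≤ denIdeal F U hx v := by
  refine Ideal.exists_pow_le_of_le_radical_of_fg ?_ ((isNoetherianRing_iff_ideal_fg _).1 ‹_› _)
  rw [Ideal.mul_le]
  intro q hq e' he'
  rw [Ideal.radical_eq_sInf, Ideal.mem_sInf]
  rintro 𝔭 ⟨hle, h𝔭⟩
  by_contra hqe
  obtain ⟨c, rfl⟩ := Ideal.mem_span_singleton'.1 he'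
  -- If 𝔭 contains all denominators of v but not q e, its point y lies in D(e) and differs from Q,
  -- so v ∈ 𝓕_y has a denominator outside 𝔭.
  let y : X := hU.fromSpec ⟨𝔭, h𝔭⟩
  have hy (a : Γ(X, U)) : y ∈ X.basicOpen a ↔ a ∉ 𝔭 := by
    change (⟨𝔭, h𝔭⟩ : PrimeSpectrum Γ(X, U)) ∈ (hU.fromSpec ⁻¹ᵁ X.basicOpen a) ↔ _
    rw [hU.fromSpec_preimage_basicOpen]
    rfl
  have hyq : y ∈ X.basicOpen q := (hy q).2 fun h ↦ hqe (𝔭.mul_mem_right _ h)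
  have hye : y ∈ X.basicOpen e :=
    (hy e).2 fun h ↦ hqe (𝔭.mul_mem_left _ (𝔭.mul_mem_left _ h))
  have hyQ : y ≠ Q := by
    rintro h
    exact mem_vanIdeal.1 hq (h ▸ hyq)
  obtain ⟨b, hb, hbv⟩ := exists_smul_mem_secSub hU hx (X.basicOpen_le q hyq) (hv y hye hyQ)
  exact (hy b).1 hb (hle hbv)

end StalkSubgroups

/-! ### Extending a section by twisting with a very ample divisor -/

section VeryAmple

variable {k : Type u} [Field k] {X : Scheme.{u}} [IsIntegral X] {F : X.Modules}

/-- If `v` is a section of `𝓕` near `Q` except at the closed point `Q`, where `𝔪_Q v ⊆ 𝓕_Q`, then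
up to a unit at `Q` it extends to a section of a twist of `𝓕` by a multiple of a very ample
divisor `E` on the complement of `Q`. -/
lemma exists_twisted_section [F.IsQuasicoherent] [IsLocallyNoetherian X] {p : X ⟶ Spec (.of k)}
    {E : EffCartier X} (hE : E.IsVeryAmple p) {Q : X} (hQ : IsClosed ({Q} : Set X))
    {v : mstalk F (genericPoint X)}
    (hv : ∀ a ∈ IsLocalRing.maximalIdeal (X.presheaf.stalk Q),
      algebraMap (X.presheaf.stalk Q) X.functionField a • v ∈ stalkSub F Q)
    (hvQ : v ∉ stalkSub F Q) :
    ∃ (N : ℕ) (s : mstalk F (genericPoint X)),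
      (∀ y ≠ Q, ∀ g ∈ E.ideal y ^ N,
        algebraMap (X.presheaf.stalk y) X.functionField g • s ∈ stalkSub F y) ∧
      (∀ a ∈ IsLocalRing.maximalIdeal (X.presheaf.stalk Q), ∀ g ∈ E.ideal Q ^ N,
        algebraMap (X.presheaf.stalk Q) X.functionField (a * g) • s ∈ stalkSub F Q) ∧
      ∃ g ∈ E.ideal Q ^ N,
        algebraMap (X.presheaf.stalk Q) X.functionField g • s ∉ stalkSub F Q := by
  obtain ⟨n, i, s, hi, -, hs⟩ := hE
  let U (c : Fin (n + 1)) : X.Opens := i ⁻¹ᵁ stdOpen k n c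
  have hU (c) : IsAffineOpen (U c) :=
    (Proj.isAffineOpen_basicOpen _ _ (MvPolynomial.isHomogeneous_X k c) one_pos).preimage i
  have hcov (y : X) : ∃ c, y ∈ U c := by
    have : i y ∈ ⨆ c, stdOpen k n c := by rw [iSup_stdOpen]; trivial
    obtain ⟨c, hc⟩ := Opens.mem_iSup.1 this
    exact ⟨c, hc⟩
  have hN (c) : IsNoetherianRing Γ(X, U c) := IsLocallyNoetherian.component_noetherian ⟨U c, hU c⟩
  let e (b c : Fin (n + 1)) : Γ(X, U c) := i.app (stdOpen k n c) (coordRatio k n b c)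
  have he (b c) {y : X} (hy : y ∈ U c) : X.presheaf.germ (U c) y hy (e b c) =
      (i.stalkMap y).hom (((projSpace k n).presheaf.germ (stdOpen k n c) (i y) hy).hom
        (coordRatio k n b c)) :=
    (i.germ_stalkMap_apply (stdOpen k n c) y hy (coordRatio k n b c)).symm
  have hse (b c) {x : X} (hx : x ∈ U c) : s b = toK (U c) hx (e b c) * s c := by
    rw [(hs x c hx).2 b, ← algebraMap_germ (U c) hx hx, he]
  have hebU {b c : Fin (n + 1)} {y : X} (hy : y ∈ X.basicOpen (e b c)) : y ∈ U b := by
    have hyc : y ∈ U c := X.basicOpen_le _ hy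
    have := (X.mem_basicOpen _ y hyc).1 hy
    rw [he] at this
    exact mem_stdOpen_of_isUnit_germ hyc (isUnit_of_map_unit (i.stalkMap y).hom _ this)
  obtain ⟨a, ha⟩ := hcov Q
  obtain ⟨b, hb, hbv⟩ := exists_vanIdeal_le_denIdeal (hU a) ha hv
  have hbQ : IsUnit (X.presheaf.germ (U a) Q ha b) := (X.mem_basicOpen _ Q ha).1 hb
  set w := toK (U a) ha b • v with hw
  have hwQ : w ∉ stalkSub F Q := by
    rw [hw, ← algebraMap_germ (U a) ha ha, smul_mem_stalkSub_iff hbQ]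
    exact hvQ
  have hwm : ∀ α ∈ IsLocalRing.maximalIdeal (X.presheaf.stalk Q),
      algebraMap (X.presheaf.stalk Q) X.functionField α • w ∈ stalkSub F Q := by
    intro α hα
    rw [hw, smul_comm, ← algebraMap_germ (U a) ha ha]
    exact smul_mem_stalkSub _ (hv α hα)
  have hwy {y : X} (hy : y ∈ U a) (hyQ : y ≠ Q) : w ∈ stalkSub F y := by
    obtain ⟨q, hq, hqQ⟩ := exists_mem_basicOpen_notMem (hU a) hQ hy hyQ
    have := mem_stalkSub_of_mem_secSub ha hy (hbv (mem_vanIdeal.2 hqQ))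
    rwa [← algebraMap_germ (U a) ha hy,
      smul_mem_stalkSub_iff ((X.mem_basicOpen _ y hy).1 hq)] at this
  -- On chart c, w is known to be a section only over D(X_a / X_c) ∖ {Q}, and a power of X_a / X_c
  -- clears its poles. Allowing every M ≥ N lets one exponent serve all charts.
  have hpow (c) : ∃ N : ℕ, ∀ y ∈ U c, y ≠ Q → ∀ M ≥ N, ∀ (x : X) (hx : x ∈ U c),
      toK (U c) hx (e a c) ^ M • w ∈ stalkSub F y := by
    by_cases hc : ∃ x, x ∈ U c
    swap
    · exact ⟨0, fun y hy ↦ (hc ⟨y, hy⟩).elim⟩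
    obtain ⟨x, hx⟩ := hc
    obtain ⟨N, hN⟩ := exists_pow_le_denIdeal (hU c) hx Q (e a c)
      (fun y hy hyQ ↦ hwy (hebU hy) hyQ)
    refine ⟨N, fun y hy hyQ M hM x' hx' ↦ ?_⟩
    obtain ⟨q, hq, hqQ⟩ := exists_mem_basicOpen_notMem (hU c) hQ hy hyQ
    have h1 := hN (Ideal.pow_mem_pow
      (Ideal.mul_mem_mul (mem_vanIdeal.2 hqQ) (Ideal.mem_span_singleton_self (e a c))) N)
    have h2 := mem_stalkSub_of_mem_secSub hx hy h1
    rw [mul_pow, map_mul, mul_smul, ← algebraMap_germ (U c) hx hy, smul_mem_stalkSub_iff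
      (by rw [map_pow]; exact ((X.mem_basicOpen _ y hy).1 hq).pow N)] at h2
    rw [← map_pow, ← Nat.sub_add_cancel hM, pow_add, map_mul, mul_smul,
      ← algebraMap_germ (U c) hx' hy (e a c ^ (M - N))]
    exact smul_mem_stalkSub _ h2
  choose N hpow using hpow
  -- On chart c a local equation of E is 1 / s_c, so multiplying s_a^N w by its N-th power gives
  -- (X_a / X_c)^N w.
  refine ⟨Finset.univ.sup N, s a ^ Finset.univ.sup N • w, ?_, ?_, ?_⟩
  · intro y hyQ g hg
    obtain ⟨c, hc⟩ := hcov y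
    obtain ⟨g₀, hg₀, hgs⟩ := (hs y c hc).1
    rw [hg₀, Ideal.span_singleton_pow, Ideal.mem_span_singleton'] at hg
    obtain ⟨h, rfl⟩ := hg
    rw [map_mul, mul_smul]
    refine smul_mem_stalkSub _ ?_
    rw [smul_smul, map_pow, ← mul_pow, hse a c hc, mul_left_comm, hgs, mul_one]
    exact hpow c y hc hyQ _ (Finset.le_sup (Finset.mem_univ c)) y hc
  · intro α hα g hg
    obtain ⟨g₀, hg₀, hgs⟩ := (hs Q a ha).1
    rw [hg₀, Ideal.span_singleton_pow, Ideal.mem_span_singleton'] at hg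
    obtain ⟨h, rfl⟩ := hg
    rw [mul_left_comm, map_mul, mul_smul]
    refine smul_mem_stalkSub _ ?_
    rw [smul_smul, map_mul, map_pow, mul_assoc, ← mul_pow, hgs, one_pow, mul_one]
    exact hwm α hα
  · obtain ⟨g₀, hg₀, hgs⟩ := (hs Q a ha).1
    refine ⟨g₀ ^ Finset.univ.sup N, Ideal.pow_mem_pow (hg₀ ▸ Ideal.mem_span_singleton_self g₀) _, ?_⟩
    rw [smul_smul, map_pow, ← mul_pow, hgs, one_pow, one_smul]
    exact hwQ

end VeryAmple

/-! ### Local equations of a divisor with cycle dC -/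

section Cycle

variable {X : Scheme.{u}}

/-- The spectrum of the local ring at x embeds in X as the set of generizations of x, which is
closed under generization; coheights therefore agree. -/
lemma ringKrullDim_stalk_fromSpecStalk (x : X) (𝔭 : Spec (X.presheaf.stalk x)) :
    ringKrullDim (X.presheaf.stalk (X.fromSpecStalk x 𝔭)) = 𝔭.asIdeal.height := by
  have hemb := (X.fromSpecStalk x).isEmbedding
  have hle (a b : Spec (X.presheaf.stalk x)) :
      X.fromSpecStalk x a ≤ X.fromSpecStalk x b ↔ a ≤ b := by
    rw [Scheme.le_iff_specializes, Scheme.le_iff_specializes, hemb.toIsInducing.specializes_iff]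
  have hlt (a b : Spec (X.presheaf.stalk x)) :
      X.fromSpecStalk x a < X.fromSpecStalk x b ↔ a < b := by
    simp only [lt_iff_le_not_ge, hle]
  rw [ringKrullDim_stalk_eq_coheight, idealHeight_eq_coheight]
  congr 1
  refine (Order.coheight_eq_of_strictMono (X.fromSpecStalk x) (fun a b h ↦ (hlt a b).2 h) ?_ 𝔭).symm
  intro a b hab
  have h1 : b ⤳ x := (Scheme.le_iff_specializes.1 hab.le).trans (by
    have : X.fromSpecStalk x a ∈ Set.range (X.fromSpecStalk x) := ⟨a, rfl⟩
    rwa [Scheme.range_fromSpecStalk] at this)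
  have h2 : b ∈ Set.range (X.fromSpecStalk x) := by rwa [Scheme.range_fromSpecStalk]
  obtain ⟨c, rfl⟩ := h2
  exact ⟨c, (hlt a c).1 hab, rfl⟩

/-- A prime ideal of the local ring at `x` is the ideal of a generization of `x`. -/
lemma exists_specializes_comap_eq (x : X) (𝔭 : Spec (X.presheaf.stalk x)) :
    ∃ (y : X) (h : y ⤳ x), (IsLocalRing.maximalIdeal (X.presheaf.stalk y)).comap
      (X.presheaf.stalkSpecializes h).hom = 𝔭.asIdeal ∧
      ringKrullDim (X.presheaf.stalk y) = 𝔭.asIdeal.height := by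
  have h : X.fromSpecStalk x 𝔭 ⤳ x := by
    have : X.fromSpecStalk x 𝔭 ∈ Set.range (X.fromSpecStalk x) := ⟨𝔭, rfl⟩
    rwa [Scheme.range_fromSpecStalk] at this
  refine ⟨_, h, ?_, ringKrullDim_stalk_fromSpecStalk x 𝔭⟩
  have h1 : X.fromSpecStalk x (Spec.map (X.presheaf.stalkSpecializes h)
      (IsLocalRing.closedPoint _)) = X.fromSpecStalk x 𝔭 :=
    (DFunLike.congr_fun (congrArg (fun g ↦ g.base.hom)
      (Scheme.SpecMap_stalkSpecializes_fromSpecStalk h)) _).trans Scheme.fromSpecStalk_closedPoint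
  have h2 := (X.fromSpecStalk x).isEmbedding.injective h1
  exact congrArg PrimeSpectrum.asIdeal h2

/-- If the cycle of `E` is `d C`, then a local equation of `E` at a point where `C` has the local
equation `f` divides `f ^ d`. -/
lemma pow_mem_ideal_of_hasCycle [IsIntegral X] [IsLocallyNoetherian X] {C : IrreducibleCloseds X}
    {P : X} (hP : P ∈ C) (hdim : ringKrullDim (X.presheaf.stalk (gen C)) = 1)
    {f : X.presheaf.stalk P} (hf : Ideal.span {f} = curveIdeal C hP) {E : EffCartier X} {d : ℕ}
    (hE : HasCycle E d C) : f ^ d ∈ E.ideal P := by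
  obtain ⟨U, hPU, g, hg⟩ := E.locally_principal P
  have hyU {y : X} (h : y ⤳ P) : y ∈ U := h.mem_open U.2 hPU
  have hf' : f ∈ curveIdeal C hP := hf ▸ Ideal.mem_span_singleton_self f
  have hfu : ¬ IsUnit f := fun h ↦ hf' (h.map _)
  have hg0 := nonZeroDivisors.ne_zero (hg P hPU).1
  -- Write g = f^e h with f ∤ h; the goal is that h is a unit and e ≤ d.
  obtain ⟨e, h, hfh, hgh⟩ := WfDvdMonoid.max_power_factor' hg0 hfu
  have hhC : h ∉ curveIdeal C hP := by
    rwa [← hf, Ideal.mem_span_singleton]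
  have hh0 : h ≠ 0 := by rintro rfl; exact hfh (dvd_zero f)
  have hhu : IsUnit h := by
    by_contra hh
    -- By Krull's theorem a minimal prime over a nonunit h has height one. It is a codimension one
    -- point other than the generic point of C at which E has positive multiplicity.
    obtain ⟨𝔭, h𝔭⟩ := Ideal.nonempty_minimalPrimes
      (Ideal.span_singleton_eq_top.not.2 hh : Ideal.span {h} ≠ ⊤)
    have h1 := Ideal.height_le_one_of_isPrincipal_of_mem_minimalPrimes _ 𝔭 h𝔭
    have hh𝔭 : h ∈ 𝔭 := h𝔭.1.2 (Ideal.mem_span_singleton_self h)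
    have h2 : 𝔭.height ≠ 0 := by
      rw [Ne, Ideal.height_eq_zero_iff_eq_bot]
      rintro rfl
      exact hh0 hh𝔭
    obtain ⟨y, hyP, hy, hydim⟩ := exists_specializes_comap_eq P ⟨𝔭, h𝔭.1.1⟩
    have h3 : 𝔭.height = 1 := le_antisymm h1 (Order.one_le_iff_ne_zero.2 h2)
    have h4 := hE y (by rw [hydim, h3]; rfl)
    have h5 : y ≠ gen C := by
      rintro rfl
      exact hhC (hy.ge hh𝔭)
    have h6 := h4.2 h5
    rw [Module.length_eq_zero_iff, Ideal.Quotient.subsingleton_iff, (hg y (hyU hyP)).2,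
      Ideal.span_singleton_eq_top, ← X.presheaf.germ_stalkSpecializes_apply hPU hyP, hgh,
      map_mul] at h6
    exact (hy.ge hh𝔭) (isUnit_of_mul_isUnit_right h6)
  -- At the generic point of C the order of g is e · ord f = d, and ord f ≥ 1.
  have he : e ≤ d := by
    have h1 := (hE (gen C) hdim).1 rfl
    rw [(hg _ (hyU (gen_specializes C hP))).2,
      ← X.presheaf.germ_stalkSpecializes_apply hPU (gen_specializes C hP), hgh] at h1
    change Ring.ord _ _ = _ at h1
    rw [map_mul, Ring.ord_mul_of_isUnit_right (hhu.map _), map_pow] at h1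
    rcases Nat.eq_zero_or_pos e with rfl | hepos
    · exact Nat.zero_le _
    set σ := (X.presheaf.stalkSpecializes (gen_specializes C hP)).hom f with hσ
    have hσ0 : σ ≠ 0 := by
      intro h0
      have h2 := (hg _ (hyU (gen_specializes C hP))).1
      rw [← X.presheaf.germ_stalkSpecializes_apply hPU (gen_specializes C hP), hgh, map_mul,
        map_pow] at h2
      refine nonZeroDivisors.ne_zero h2 ?_
      change σ ^ e * _ = 0
      rw [h0, zero_pow hepos.ne', zero_mul]
    rw [Ring.ord_pow (mem_nonZeroDivisors_of_ne_zero hσ0)] at h1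
    have h2 : 1 ≤ Ring.ord _ σ := by
      rw [Order.one_le_iff_ne_zero, Ring.ord, Ne, Module.length_eq_zero_iff,
        Ideal.Quotient.subsingleton_iff, Ideal.span_singleton_eq_top]
      exact hf'
    have h3 : (e : ℕ∞) ≤ d := by
      rw [← h1, nsmul_eq_mul]
      exact le_mul_of_one_le_right (by simp) h2
    exact_mod_cast h3
  rw [(hg P hPU).2, hgh, Ideal.mem_span_singleton]
  exact (hhu.mul_right_dvd).2 (pow_dvd_pow f he)

end Cycle

/-! ### Divisibility by a variable in power series rings -/

section PowerSeries

open MvPowerSeries in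
/-- The variables of a power series ring over a domain are prime. -/
lemma prime_X_mvPowerSeries {σ R : Type*} [CommRing R] [IsDomain R] (s : σ) :
    Prime (MvPowerSeries.X s : MvPowerSeries σ R) := by
  classical
  -- Modulo X_s a series may be replaced by its part free of X_s. A product of two such parts that
  -- is divisible by X_s vanishes, so one factor is zero.
  have hX (a : MvPowerSeries σ R) : ∃ c, X s ∣ a - c ∧ ∀ m : σ →₀ ℕ, m s ≠ 0 → coeff m c = 0 := by
    obtain ⟨c, hc⟩ : ∃ c : MvPowerSeries σ R, ∀ m, coeff m c = if m s = 0 then coeff m a else 0 :=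
      ⟨fun m ↦ if m s = 0 then coeff m a else 0, fun _ ↦ rfl⟩
    refine ⟨c, X_dvd_iff.2 fun m hm ↦ ?_, fun m hm ↦ ?_⟩
    · rw [map_sub, hc, if_pos hm, sub_self]
    · rw [hc, if_neg hm]
  refine ⟨?_, ?_, ?_⟩
  · intro h
    have := congrArg (coeff (Finsupp.single s 1)) h
    simp [coeff_index_single_self_X] at this
  · intro h
    have := h.map (constantCoeff (σ := σ) (R := R))
    simp at this
  · intro a b hab
    obtain ⟨c, hac, hc⟩ := hX a
    obtain ⟨d, hbd, hd⟩ := hX b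
    have hcd : X s ∣ c * d := by
      have : c * d = a * b - ((a - c) * b + c * (b - d)) := by ring
      rw [this]
      exact dvd_sub hab (dvd_add (hac.mul_right _) (hbd.mul_left _))
    have h0 : c * d = 0 := by
      ext m
      by_cases hm : m s = 0
      · exact X_dvd_iff.1 hcd m hm
      · rw [coeff_mul, map_zero]
        refine Finset.sum_eq_zero fun p hp ↦ ?_
        have hp' : p.1 s + p.2 s = m s := by
          rw [← Finset.HasAntidiagonal.mem_antidiagonal.1 hp]; rfl
        by_cases h1 : p.1 s = 0
        · rw [hd p.2 (by omega), mul_zero]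
        · rw [hc p.1 h1, zero_mul]
    rcases mul_eq_zero.1 h0 with rfl | rfl
    · exact .inl (by simpa using hac)
    · exact .inr (by simpa using hbd)

lemma varT_not_dvd_varU (k : Type u) [Field k] : ¬ varT k ∣ varU k := by
  intro h
  have := MvPowerSeries.X_dvd_iff.1 h (Finsupp.single 0 1) (by simp)
  simp [MvPowerSeries.coeff_index_single_self_X] at this

end PowerSeries

/-! ### Geometric data: the extension argument -/

section Data

attribute [instance] GeometricData.isIntegral

variable {k : Type u} [Field k] {r : ℕ} (D : GeometricData k r)

lemma GeometricData.isLocallyNoetherian : IsLocallyNoetherian D.X :=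
  D.isProjective.isLocallyNoetherian

lemma GeometricData.f_mem : D.f ∈ curveIdeal D.C D.P_mem :=
  D.f_spec ▸ Ideal.mem_span_singleton_self D.f

/-- The maximal ideal of the completion is extended from 𝔪_P, so otherwise π would map all of it
into (t). But some w has π(w) ≡ u modulo t; it is a nonunit since π(w) has zero constant term, and t
does not divide u. -/
lemma GeometricData.exists_not_dvd_π :
    ∃ v ∈ IsLocalRing.maximalIdeal (D.X.presheaf.stalk D.P),
      ¬ varT k ∣ D.π (toCompl D.X D.P v) := by
  by_contra! h
  have := D.P_regular
  obtain ⟨w, hw⟩ := D.π_surjective (Ideal.Quotient.mk _ (varU k))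
  have hw' : varT k ∣ D.π w - varU k := Ideal.mem_span_singleton.1 (Ideal.Quotient.eq.1 hw)
  have hwm : w ∈ IsLocalRing.maximalIdeal (complStalk D.X D.P) := by
    intro hu
    have h1 := (hu.map D.π).map (MvPowerSeries.constantCoeff (σ := Fin 2) (R := k))
    obtain ⟨c, hc⟩ := hw'
    rw [sub_eq_iff_eq_add.1 hc] at h1
    simp at h1
  have hle : IsLocalRing.maximalIdeal (complStalk D.X D.P) ≤
      (Ideal.span {varT k}).comap D.π := by
    rw [AdicCompletion.maximalIdeal_eq_map, Ideal.map_le_iff_le_comap]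
    exact fun v hv ↦ Ideal.mem_span_singleton.2 (h v hv)
  have h2 : varT k ∣ D.π w := Ideal.mem_span_singleton.1 (hle hwm)
  exact varT_not_dvd_varU k ((dvd_sub_right h2).1 hw')

lemma GeometricData.pow_f_mem : D.f ^ D.d ∈ D.C'.ideal D.P := by
  have := D.isLocallyNoetherian
  exact pow_mem_ideal_of_hasCycle D.P_mem D.codim_eq_one D.f_spec D.C'_cycle

/-- A local equation invertible at Q would be invertible at the generic point of C, where the
multiplicity d is positive. -/
lemma GeometricData.ideal_le {Q : D.X} (hQ : Q ∈ D.C) :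
    D.C'.ideal Q ≤ IsLocalRing.maximalIdeal (D.X.presheaf.stalk Q) := by
  obtain ⟨U, hU, g, hg⟩ := D.C'.locally_principal Q
  have hgen := (gen_specializes D.C hQ).mem_open U.2 hU
  rw [(hg Q hU).2, Ideal.span_singleton_le_iff_mem, IsLocalRing.mem_maximalIdeal]
  intro hu
  have h1 := (D.C'_cycle _ D.codim_eq_one).1 rfl
  have h2 := hu.map (D.X.presheaf.stalkSpecializes (gen_specializes D.C hQ)).hom
  change IsUnit (D.X.presheaf.stalkSpecializes (gen_specializes D.C hQ)
    (D.X.presheaf.germ U Q hU g)) at h2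
  rw [D.X.presheaf.germ_stalkSpecializes_apply] at h2
  have h3 := D.d_isLeast.1.1
  have h4 : Module.length (D.X.presheaf.stalk (gen D.C))
      (D.X.presheaf.stalk (gen D.C) ⧸ D.C'.ideal (gen D.C)) = 0 := by
    rw [Module.length_eq_zero_iff, Ideal.Quotient.subsingleton_iff, (hg _ hgen).2,
      Ideal.span_singleton_eq_top]
    exact h2
  rw [h4] at h1
  exact h3.ne (by exact_mod_cast h1)

/-- If `𝔪_P z ⊆ 𝓕_P`, then `φ(f z)` is divisible by `π(f)`. -/
lemma GeometricData.dvd_φ {z : mstalk D.F (genericPoint D.X)}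
    (hz : ∀ a ∈ IsLocalRing.maximalIdeal (D.X.presheaf.stalk D.P),
      algebraMap (D.X.presheaf.stalk D.P) D.X.functionField a • z ∈ stalkSub D.F D.P)
    {m : mstalk D.F D.P} (hm : cosp D.F (genericPoint_specializes' D.P) m =
      algebraMap (D.X.presheaf.stalk D.P) D.X.functionField D.f • z) :
    D.π (toCompl D.X D.P D.f) ∣ D.φ m := by
  have := D.quasicoherent
  -- From v (f z) = f (v z) with v z ∈ 𝓕_P, t^r divides π(v) φ(f z); the prime t does not divide
  -- π(v).
  obtain ⟨v, hv, hvt⟩ := D.exists_not_dvd_π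
  obtain ⟨mv, hmv⟩ := hz v hv
  have h1 : v • m = D.f • mv := by
    apply cosp_injective D.torsionFree
    refine (cosp_smul D.F _ v m).trans (Eq.trans ?_ (cosp_smul D.F _ D.f mv).symm)
    rw [hm, hmv]
    exact smul_comm (algebraMap (D.X.presheaf.stalk D.P) D.X.functionField v)
      (algebraMap (D.X.presheaf.stalk D.P) D.X.functionField D.f) z
  have h2 := congrArg D.φ h1
  rw [D.φ_smul, D.φ_smul] at h2
  have : IsDomain (PS k) := NoZeroDivisors.to_isDomain _
  have hass := Ideal.span_singleton_eq_span_singleton.1 D.π_f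
  have h3 : varT k ^ r ∣ D.π (toCompl D.X D.P v) * D.φ m :=
    h2 ▸ (hass.symm.dvd.mul_right _)
  exact hass.dvd.trans ((prime_X_mvPowerSeries 1).pow_dvd_of_dvd_mul_left r hvt h3)

/-- A coherent sheaf of a geometric data has depth at least two at the closed points of `C`: an
element of the generic stalk that is multiplied by `𝔪_Q` into `𝓕_Q` belongs to `𝓕_Q`. -/
lemma GeometricData.mem_stalkSub {Q : D.X} (hQC : Q ∈ D.C) (hQ : IsClosed ({Q} : Set D.X))
    {v : mstalk D.F (genericPoint D.X)}
    (hv : ∀ a ∈ IsLocalRing.maximalIdeal (D.X.presheaf.stalk Q),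
      algebraMap (D.X.presheaf.stalk Q) D.X.functionField a • v ∈ stalkSub D.F Q) :
    v ∈ stalkSub D.F Q := by
  by_contra hvQ
  have := D.isLocallyNoetherian
  have := D.quasicoherent
  obtain ⟨N, s, hs1, hs2, g, hg, hgs⟩ := exists_twisted_section D.C'_veryAmple hQ hv hvQ
  -- At Q, one of the N + 1 factors from the ideal of C' lies in 𝔪_Q; this is where Q ∈ C enters.
  have hsW : s ∈ twistSections D.F (D.C'.mul (N + 1)) := by
    intro x c hc
    change c ∈ D.C'.ideal x ^ (N + 1) at hc
    by_cases hx : x = Q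
    · subst hx
      rw [pow_succ'] at hc
      induction hc using Submodule.mul_induction_on' with
      | mem_mul_mem a ha b hb => exact hs2 a (D.ideal_le hQC ha) b hb
      | add a _ b _ ha hb =>
        rw [map_add, add_smul]
        exact add_mem ha hb
    · exact hs1 x hx c (Ideal.pow_le_pow_right N.le_succ hc)
  set κ := algebraMap (D.X.presheaf.stalk D.P) D.X.functionField with hκ
  have hfN : D.f ^ (N * D.d) ∈ D.C'.ideal D.P ^ N := by
    rw [mul_comm, pow_mul]
    exact Ideal.pow_mem_pow D.pow_f_mem N
  have hz (a) (ha : a ∈ IsLocalRing.maximalIdeal (D.X.presheaf.stalk D.P)) :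
      κ a • κ (D.f ^ (N * D.d)) • s ∈ stalkSub D.F D.P := by
    rw [smul_smul, ← map_mul]
    by_cases hP : D.P = Q
    · subst hP
      exact hs2 a ha _ hfN
    · exact hs1 _ hP _ (Ideal.mul_mem_left _ _ hfN)
  have hfm : D.f ∈ IsLocalRing.maximalIdeal (D.X.presheaf.stalk D.P) :=
    fun hu ↦ D.f_mem (hu.map _)
  obtain ⟨m, hm⟩ := hz D.f hfm
  -- The series w plays the role of φ(z), although z = f^(Nd) s need not lie in 𝓕_P.
  obtain ⟨w, hw⟩ := D.dvd_φ hz hm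
  obtain ⟨ψ, hψ, -, hψs⟩ := D.φ_iso N
  obtain ⟨ψ', hψ', hψi, -⟩ := D.φ_iso (N + 1)
  obtain ⟨s', hs'⟩ := hψs (Ideal.Quotient.mk _ w)
  have hs'W : (s' : mstalk D.F (genericPoint D.X)) ∈ twistSections D.F (D.C'.mul (N + 1)) :=
    fun x g hg ↦ s'.2 x g (Ideal.pow_le_pow_right N.le_succ hg)
  set δ : twistSections D.F (D.C'.mul (N + 1)) := ⟨s, hsW⟩ - ⟨s', hs'W⟩ with hδ
  set πf := D.π (toCompl D.X D.P D.f) with hπf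
  -- Only f z, not z, is known to lie in 𝓕_P, so f^d z is written as f^(d-1) (f z).
  obtain ⟨e, he⟩ : ∃ e, D.d = e + 1 := Nat.exists_eq_succ_of_ne_zero D.d_isLeast.1.1.ne'
  have hψδ : ψ' δ = D.f ^ e • m - D.f ^ D.d • ψ s' := by
    apply cosp_injective D.torsionFree
    refine (hψ' δ).trans (Eq.trans ?_ ((map_sub (cosp D.F _) _ _).trans (congrArg₂ (· - ·)
      (cosp_smul D.F _ (D.f ^ e) m) (cosp_smul D.F _ (D.f ^ D.d) (ψ s')))).symm)
    change κ (D.f ^ ((N + 1) * D.d)) • (s - s'.1) = κ (D.f ^ e) • cosp D.F _ m -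
      κ (D.f ^ D.d) • cosp D.F _ (ψ s')
    rw [hm, hψ, ← hκ, smul_smul, smul_smul, smul_smul, ← map_mul, ← map_mul, ← map_mul, ← pow_succ,
      ← he, ← pow_add, smul_sub, add_one_mul, add_comm]
  have hφ : D.φ (ψ' δ) = πf ^ D.d * (w - D.φ (ψ s')) := by
    rw [hψδ, map_sub, D.φ_smul, D.φ_smul, hw, map_pow, map_pow, map_pow, map_pow, he]
    ring
  have hπ : πf ∈ Ideal.span {varU k, varT k} ^ r := by
    have h1 : πf ∈ Ideal.span {varT k ^ r} := D.π_f ▸ Ideal.mem_span_singleton_self _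
    refine (Ideal.span_singleton_le_iff_mem _).2 ?_ h1
    exact Ideal.pow_mem_pow (Ideal.subset_span (by simp)) r
  have hδ0 : δ = 0 := by
    apply hψi
    change Ideal.Quotient.mk _ (D.φ (ψ' δ)) = Ideal.Quotient.mk _ (D.φ (ψ' 0))
    -- The factor π(f)^d contributes dr to the order, raising Ndr + 1 to (N+1)dr + 1.
    rw [map_zero, map_zero, map_zero, Ideal.Quotient.eq_zero_iff_mem, hφ]
    have h1 : w - D.φ (ψ s') ∈ Ideal.span {varU k, varT k} ^ (N * D.d * r + 1) :=
      Ideal.Quotient.eq.1 hs'.symm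
    have h2 := Ideal.mul_mem_mul (Ideal.pow_mem_pow hπ D.d) h1
    rw [← pow_mul, ← pow_add] at h2
    convert h2 using 2
    ring
  have hss : s = s' := congrArg Subtype.val (sub_eq_zero.1 hδ0)
  exact hgs (hss ▸ s'.2 Q g hg)

end Data

/-! ### Regular sequences, Cohen–Macaulay modules and freeness -/

section CommutativeAlgebra

open IsLocalRing RingTheory.Sequence

variable {R : Type*} [CommRing R] [IsLocalRing R]
  {M : Type*} [AddCommGroup M] [Module R M] [Module.Finite R M]

lemma isRegular_singleton [Nontrivial M] {a : R} (ha : a ∈ maximalIdeal R)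
    (h : IsSMulRegular M a) : IsRegular M [a] := by
  rw [IsLocalRing.isRegular_iff_isWeaklyRegular_of_subset_maximalIdeal (by simpa using ha)]
  simpa using h

lemma isRegular_pair [Nontrivial M] {a b : R} (ha : a ∈ maximalIdeal R) (hb : b ∈ maximalIdeal R)
    (h : IsSMulRegular M a) (h' : IsSMulRegular (QuotSMulTop a M) b) : IsRegular M [a, b] := by
  rw [IsLocalRing.isRegular_iff_isWeaklyRegular_of_subset_maximalIdeal 
    (by simpa using ⟨ha, hb⟩)]
  simpa [isWeaklyRegular_cons_iff] using ⟨h, h'⟩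

variable [IsNoetherianRing R]

/-- If no nonzero element of `M` is killed by the maximal ideal, then the maximal ideal contains an
`M`-regular element. -/
lemma exists_isSMulRegular_of_socle_eq_zero
    (h : ∀ m : M, (∀ a ∈ maximalIdeal R, a • m = 0) → m = 0) :
    ∃ a ∈ maximalIdeal R, IsSMulRegular M a := by
  by_contra! hn
  -- Prime avoidance puts the maximal ideal inside a single associated prime, the annihilator of
  -- some x; then x is in the socle, hence zero.
  have h1 : (maximalIdeal R : Set R) ⊆ ⋃ p ∈ associatedPrimes R M, p := by
    rw [biUnion_associatedPrimes_eq_compl_regular]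
    exact fun a ha ↦ hn a ha
  obtain ⟨p, hp, hle⟩ := ((maximalIdeal R).subset_union_prime_finite (associatedPrimes.finite R M)
    (f := id) 0 0 fun _ h _ _ ↦ h.1).1 h1
  rw [AssociatedPrimes.mem_iff, isAssociatedPrime_iff] at hp
  obtain ⟨hprime, x, rfl⟩ := hp
  have hx : x = 0 := h x fun a ha ↦ by simpa using hle ha
  exact hprime.ne_top (by simp [hx])

/-- Each term of a regular sequence lowers the dimension of the support by one, and the final
quotient is nonzero. -/
lemma length_le_supportDim {rs : List R} (h : IsRegular M rs) :
    ((rs.length : ℕ∞) : WithBot ℕ∞) ≤ Module.supportDim R M := by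
  rw [← Module.supportDim_add_length_eq_supportDim_of_isRegular rs h]
  have : Nontrivial (M ⧸ Ideal.ofList rs • (⊤ : Submodule R M)) :=
    Submodule.Quotient.nontrivial_iff.2 h.top_ne_smul.symm
  obtain ⟨n, hn⟩ := WithBot.ne_bot_iff_exists.1
    (Module.supportDim_ne_bot_of_nontrivial R (M ⧸ Ideal.ofList rs • (⊤ : Submodule R M)))
  rw [← hn]
  exact_mod_cast le_add_self

lemma depth_le_supportDim [Nontrivial M] :
    ((depth R M : ℕ∞) : WithBot ℕ∞) ≤ Module.supportDim R M := by
  obtain ⟨n, hn⟩ := WithBot.ne_bot_iff_exists.1 (Module.supportDim_ne_bot_of_nontrivial R M)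
  rw [← hn, WithBot.coe_le_coe]
  refine iSup_le fun rs ↦ ?_
  have := length_le_supportDim rs.2.1
  rwa [← hn, WithBot.coe_le_coe] at this

/-- A module with a regular sequence of length at least the dimension of the ring is
Cohen-Macaulay. -/
lemma isCohenMacaulay_of_isRegular {rs : List R} (h : IsRegular M rs)
    (hrs : ∀ a ∈ rs, a ∈ maximalIdeal R) (hdim : ringKrullDim R ≤ (rs.length : ℕ∞)) :
    IsCohenMacaulay R M ∧ depth R M = rs.length := by
  have hM : Nontrivial M := h.nontrivial
  have h1 : (rs.length : ℕ∞) ≤ depth R M := le_iSup_of_le ⟨rs, h, hrs⟩ le_rfl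
  have h2 : Module.supportDim R M ≤ (rs.length : ℕ∞) :=
    (Module.supportDim_le_ringKrullDim R M).trans hdim
  have h3 : depth R M = rs.length :=
    le_antisymm (WithBot.coe_le_coe.1 (depth_le_supportDim.trans h2)) h1
  exact ⟨⟨‹_›, hM, le_antisymm depth_le_supportDim (h2.trans (WithBot.coe_le_coe.2 h1))⟩, h3⟩

-- The hypothesis says that the socle of M / gM is zero, in terms of elements of M.
open Pointwise in
lemma exists_isSMulRegular_quotSMulTop {g : R}
    (h : ∀ m : M, (∀ a ∈ maximalIdeal R, ∃ n : M, a • m = g • n) → ∃ n : M, m = g • n) :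
    ∃ a ∈ maximalIdeal R, IsSMulRegular (QuotSMulTop g M) a := by
  have hmk (m : M) : (Submodule.Quotient.mk m : QuotSMulTop g M) = 0 ↔ ∃ n, m = g • n := by
    rw [Submodule.Quotient.mk_eq_zero, Submodule.mem_smul_pointwise_iff_exists]
    simp [eq_comm]
  refine exists_isSMulRegular_of_socle_eq_zero fun m hm ↦ ?_
  obtain ⟨m, rfl⟩ := Submodule.Quotient.mk_surjective _ m
  exact (hmk m).2 (h m fun a ha ↦ (hmk _).1 (hm a ha))

/-- A finite module `M` is free if `f` is `M`-regular, `R / f` is a discrete valuation ring or a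
field and the maximal ideal contains an `M / fM`-regular element. -/
lemma free_of_isPrincipalIdealRing_quotient {f b : R} (hf : f ∈ maximalIdeal R)
    (hprime : (Ideal.span {f}).IsPrime) [IsPrincipalIdealRing (R ⧸ Ideal.span {f})]
    (hfM : IsSMulRegular M f) (hb : b ∈ maximalIdeal R)
    (hbM : IsSMulRegular (QuotSMulTop f M) b) : Module.Free R M := by
  have hfin : Module.FinitePresentation R M := Module.finitePresentation_of_finite R M
  rw [← Module.free_quotSMulTop_iff_free R M (x := f)
    (by rwa [IsLocalRing.jacobson_eq_maximalIdeal ⊥ bot_ne_top]) hfM]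
  have : Module.Finite (R ⧸ Ideal.span {f}) (QuotSMulTop f M) :=
    Module.Finite.of_restrictScalars_finite R (R ⧸ Ideal.span {f}) (QuotSMulTop f M)
  have hloc : IsLocalRing (R ⧸ Ideal.span {f}) :=
    .of_surjective' (Ideal.Quotient.mk _) Ideal.Quotient.mk_surjective
  suffices Module.IsTorsionFree (R ⧸ Ideal.span {f}) (QuotSMulTop f M) from inferInstance
  obtain ⟨ϖ, hϖ⟩ := IsPrincipalIdealRing.principal (maximalIdeal (R ⧸ Ideal.span {f}))
  have hϖ' : maximalIdeal (R ⧸ Ideal.span {f}) = Ideal.span {ϖ} := hϖ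
  have hbϖ : ϖ ∣ Ideal.Quotient.mk (Ideal.span {f}) b := by
    rw [← Ideal.mem_span_singleton, ← hϖ']
    intro hu
    have := IsLocalHom.of_surjective (Ideal.Quotient.mk (Ideal.span {f}))
      Ideal.Quotient.mk_surjective
    exact hb ((isUnit_map_iff (Ideal.Quotient.mk (Ideal.span {f})) b).1 hu)
  -- Since ϖ divides b, anything killed by ϖ is killed by b; every nonzero element of R / f is a
  -- unit times a power of ϖ.
  have hreg : IsSMulRegular (QuotSMulTop f M) ϖ := by
    obtain ⟨c, hc⟩ := hbϖ
    rw [isSMulRegular_iff_right_eq_zero_of_smul]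
    intro x hx
    refine hbM.right_eq_zero_of_smul ?_
    have : b • x = Ideal.Quotient.mk (Ideal.span {f}) b • x := rfl
    rw [this, hc, mul_comm, mul_smul, hx, smul_zero]
  refine ⟨fun a ha ↦ ?_⟩
  have hu : ¬ IsUnit ϖ := by
    have : ϖ ∈ maximalIdeal (R ⧸ Ideal.span {f}) := hϖ' ▸ Ideal.mem_span_singleton_self ϖ
    exact this
  obtain ⟨n, h, hh, rfl⟩ := WfDvdMonoid.max_power_factor' ha.ne_zero hu
  have hhu : IsUnit h := by
    by_contra hn
    have : h ∈ maximalIdeal (R ⧸ Ideal.span {f}) := hn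
    rw [hϖ', Ideal.mem_span_singleton] at this
    exact hh this
  exact (hreg.pow n).mul (hhu.isSMulRegular _)

end CommutativeAlgebra

/-! ### Points of the curve: generic or closed -/

section Dimension

attribute [local instance] specializationOrder in
lemma coheight_le_topologicalKrullDim {X : Scheme.{u}} (x : X) :
    (Order.coheight x : WithBot ℕ∞) ≤ topologicalKrullDim X := by
  rw [topologicalKrullDim, Order.krullDim_eq_of_orderIso (irreducibleSetEquivPoints (α := X))]
  exact Order.coheight_le_krullDim x

variable {k : Type u} [Field k] {r : ℕ} (D : GeometricData k r)

lemma GeometricData.coheight_le (x : D.X) : Order.coheight x ≤ 2 := by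
  have h := coheight_le_topologicalKrullDim x
  rw [D.dim_eq_two] at h
  exact WithBot.coe_le_coe.1 h

lemma GeometricData.ringKrullDim_le (x : D.X) : ringKrullDim (D.X.presheaf.stalk x) ≤ (2 : ℕ∞) := by
  rw [ringKrullDim_stalk_eq_coheight]
  exact WithBot.coe_le_coe.2 (D.coheight_le x)

lemma lt_of_specializes_of_ne {X : Scheme.{u}} {x y : X} (h : y ⤳ x) (hne : y ≠ x) : x < y :=
  lt_iff_le_not_ge.2 ⟨h, fun h' ↦ hne (h.antisymm h').eq⟩

/-- A further proper specialization of Q would have coheight at least 3, as the generic point of C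
already has coheight 1. -/
lemma GeometricData.isClosed_of_ne_gen {Q : D.X} (hQ : Q ∈ D.C) (hne : gen D.C ≠ Q) :
    IsClosed ({Q} : Set D.X) := by
  rw [← closure_eq_iff_isClosed]
  refine subset_antisymm (fun y hy ↦ ?_) subset_closure
  by_contra hyQ
  have h1 := Order.coheight_add_one_le
    (lt_of_specializes_of_ne (specializes_iff_mem_closure.2 hy) (Ne.symm hyQ))
  have h2 := Order.coheight_add_one_le (lt_of_specializes_of_ne (gen_specializes D.C hQ) hne)
  have h3 : Order.coheight (gen D.C) = 1 := by
    have := D.codim_eq_one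
    rw [ringKrullDim_stalk_eq_coheight] at this
    exact_mod_cast this
  rw [h3] at h2
  have h4 : (1 + 1 + 1 : ℕ∞) ≤ 2 := (add_le_add_left h2 1).trans (h1.trans (D.coheight_le y))
  exact absurd h4 (by decide)

end Dimension

/-! ### Cohen–Macaulayness along C and freeness at P -/

section CohenMacaulay

variable {k : Type u} [Field k] {r : ℕ} (D : GeometricData k r)

lemma GeometricData.exists_ne_zero_mem_maximalIdeal {Q : D.X} (hQ : Q ∈ D.C) :
    ∃ g ∈ IsLocalRing.maximalIdeal (D.X.presheaf.stalk Q), g ≠ 0 := by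
  obtain ⟨U, hU, g, hg⟩ := D.C'.locally_principal Q
  refine ⟨_, D.ideal_le hQ ?_, nonZeroDivisors.ne_zero (hg Q hU).1⟩
  rw [(hg Q hU).2]
  exact Ideal.mem_span_singleton_self _

lemma GeometricData.isSMulRegular {Q : D.X} {g : D.X.presheaf.stalk Q} (hg : g ≠ 0) :
    IsSMulRegular (mstalk D.F Q) g := by
  have := D.torsionFree Q
  exact smul_right_injective _ hg

/-- At level n = 0 the global sections of 𝓕 surject onto k[[u,t]]/(u,t), which is nonzero. -/
lemma GeometricData.nontrivial_genericStalk : Nontrivial (mstalk D.F (genericPoint D.X)) := by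
  obtain ⟨ψ, -, -, hψ⟩ := D.φ_iso 0
  by_contra h
  rw [not_nontrivial_iff_subsingleton] at h
  obtain ⟨s, hs⟩ := hψ 1
  have h0 : s = 0 := Subsingleton.elim _ _
  simp only [h0, map_zero] at hs
  have h1 := (Ideal.Quotient.eq_zero_iff_mem.1 hs.symm)
  rw [zero_mul, zero_mul, zero_add, pow_one] at h1
  have h2 : Ideal.span {varU k, varT k} ≤
      RingHom.ker (MvPowerSeries.constantCoeff (σ := Fin 2) (R := k)) := by
    rw [Ideal.span_le]
    rintro _ (rfl | rfl) <;> simp [RingHom.mem_ker]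
  have h3 := h2 h1
  simp [RingHom.mem_ker] at h3

lemma GeometricData.nontrivial_mstalk (Q : D.X) : Nontrivial (mstalk D.F Q) := by
  have := D.quasicoherent
  have := D.nontrivial_genericStalk
  obtain ⟨v, hv⟩ := exists_ne (0 : mstalk D.F (genericPoint D.X))
  obtain ⟨_, ⟨U, hU, rfl⟩, hQU, -⟩ :=
    D.X.isBasis_affineOpens.exists_subset_of_mem_open (Set.mem_univ Q) isOpen_univ
  obtain ⟨b, hb, σ, h⟩ := exists_smul_eq_mgerm D.F hU (genericPoint_mem hQU) v
  refine ⟨mgerm D.F U Q hQU σ, 0, fun h0 ↦ hv ?_⟩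
  have h1 := cosp_mgerm D.F (genericPoint_specializes' Q) hQU σ
  rw [h0, map_zero] at h1
  have hu := (D.X.mem_basicOpen b _ (genericPoint_mem hQU)).1 hb
  exact hu.smul_eq_zero.1 (h.trans h1.symm)

/-- Division by `g` preserves the property of being multiplied by `𝔪_Q` into `𝓕_Q`. -/
lemma GeometricData.exists_eq_smul {Q : D.X} (hQC : Q ∈ D.C) (hQ : IsClosed ({Q} : Set D.X))
    {g : D.X.presheaf.stalk Q} (hg : g ≠ 0) {m : mstalk D.F Q}
    (hm : ∀ a ∈ IsLocalRing.maximalIdeal (D.X.presheaf.stalk Q), ∃ n : mstalk D.F Q,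
      a • m = g • n) : ∃ n : mstalk D.F Q, m = g • n := by
  have := D.quasicoherent
  set κ := algebraMap (D.X.presheaf.stalk Q) D.X.functionField with hκ
  have hg0 : κ g ≠ 0 := by
    rwa [Ne, map_eq_zero_iff _ (FaithfulSMul.algebraMap_injective _ _)]
  obtain ⟨c, hc⟩ := (IsUnit.mk0 _ hg0).exists_left_inv
  have hcosp (a : D.X.presheaf.stalk Q) (n : mstalk D.F Q) :
      cosp D.F (genericPoint_specializes' Q) (a • n) =
        κ a • cosp D.F (genericPoint_specializes' Q) n := cosp_smul D.F _ a n
  -- The extension property is applied to m / g, with c the inverse of g in the function field.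
  obtain ⟨n, hn⟩ := D.mem_stalkSub hQC hQ
    (v := c • cosp D.F (genericPoint_specializes' Q) m) (fun a ha ↦ by
      obtain ⟨n, hn⟩ := hm a ha
      refine ⟨n, ?_⟩
      rw [smul_comm, ← hκ, ← hcosp, hn, hcosp, smul_smul, hc, one_smul])
  refine ⟨n, cosp_injective D.torsionFree Q ?_⟩
  rw [hcosp, hn, smul_smul, mul_comm, hc, one_smul]

lemma GeometricData.exists_isSMulRegular (hF : IsCoherent D.F) {Q : D.X} (hQC : Q ∈ D.C)
    (hQ : IsClosed ({Q} : Set D.X)) {g : D.X.presheaf.stalk Q} (hg : g ≠ 0) :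
    ∃ a ∈ IsLocalRing.maximalIdeal (D.X.presheaf.stalk Q),
      IsSMulRegular (QuotSMulTop g (mstalk D.F Q)) a := by
  have := D.isLocallyNoetherian
  have := hF.1
  have := hF.2
  have := finite_mstalk D.F Q
  exact exists_isSMulRegular_quotSMulTop fun m hm ↦ D.exists_eq_smul hQC hQ hg hm

lemma GeometricData.isCohenMacaulay_of_isClosed (hF : IsCoherent D.F) {Q : D.X} (hQC : Q ∈ D.C)
    (hQ : IsClosed ({Q} : Set D.X)) :
    IsCohenMacaulay (D.X.presheaf.stalk Q) (mstalk D.F Q) ∧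
      depth (D.X.presheaf.stalk Q) (mstalk D.F Q) = 2 := by
  have := D.isLocallyNoetherian
  have := hF.1
  have := hF.2
  have := finite_mstalk D.F Q
  have := D.nontrivial_mstalk Q
  obtain ⟨g, hg, hg0⟩ := D.exists_ne_zero_mem_maximalIdeal hQC
  obtain ⟨a, ha, hreg⟩ := D.exists_isSMulRegular hF hQC hQ hg0
  exact isCohenMacaulay_of_isRegular (isRegular_pair hg ha (D.isSMulRegular hg0) hreg)
    (by simpa using ⟨hg, ha⟩) (D.ringKrullDim_le Q)

lemma GeometricData.isCohenMacaulay_gen (hF : IsCoherent D.F) :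
    IsCohenMacaulay (D.X.presheaf.stalk (gen D.C)) (mstalk D.F (gen D.C)) := by
  have := D.isLocallyNoetherian
  have := hF.1
  have := hF.2
  have := finite_mstalk D.F (gen D.C)
  have := D.nontrivial_mstalk (gen D.C)
  have hmem : gen D.C ∈ D.C :=
    (D.C.isIrreducible.isGenericPoint_genericPoint D.C.isClosed).mem
  obtain ⟨g, hg, hg0⟩ := D.exists_ne_zero_mem_maximalIdeal hmem
  exact (isCohenMacaulay_of_isRegular (isRegular_singleton hg (D.isSMulRegular hg0))
    (by simpa using hg) D.codim_eq_one.le).1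

lemma GeometricData.f_ne_zero : D.f ≠ 0 := by
  intro h
  have h1 := D.π_f
  rw [h, map_zero, map_zero, Ideal.span_singleton_zero, eq_comm, Ideal.span_singleton_eq_bot] at h1
  exact pow_ne_zero r (prime_X_mvPowerSeries (R := k) (1 : Fin 2)).ne_zero h1

lemma GeometricData.isPrincipalIdealRing_quotient :
    IsPrincipalIdealRing (D.X.presheaf.stalk D.P ⧸ Ideal.span {D.f}) := by
  have := D.isLocallyNoetherian
  have hprime : (Ideal.span {D.f}).IsPrime := by
    rw [D.f_spec]
    exact Ideal.comap_isPrime _ _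
  have hreg : IsRegularLocalRing (D.X.presheaf.stalk D.P ⧸ Ideal.span {D.f}) := by
    rw [D.f_spec]
    exact D.P_regular_on_C
  refine ((tfae_of_isNoetherianRing_of_isLocalRing_of_isDomain
    (D.X.presheaf.stalk D.P ⧸ Ideal.span {D.f})).out 5 0).1 ?_
  have h1 := (IsRegularLocalRing.iff_finrank_cotangentSpace _).1 hreg
  -- Dividing by f lowers the dimension to at most 1. As the quotient is regular, its cotangent
  -- space has dimension at most 1 too.
  have h2 := ringKrullDim_quotient_succ_le_of_nonZeroDivisor
    (mem_nonZeroDivisors_of_ne_zero D.f_ne_zero)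
  have h3 := h2.trans (D.ringKrullDim_le D.P)
  rw [← h1] at h3
  exact Nat.le_of_succ_le_succ (by exact_mod_cast h3)

lemma GeometricData.free_mstalk (hF : IsCoherent D.F) :
    Module.Free (D.X.presheaf.stalk D.P) (mstalk D.F D.P) := by
  have := D.isLocallyNoetherian
  have := hF.1
  have := hF.2
  have := finite_mstalk D.F D.P
  have := D.isPrincipalIdealRing_quotient
  obtain ⟨a, ha, hreg⟩ := D.exists_isSMulRegular hF D.P_mem D.P_closed D.f_ne_zero
  have hfm : D.f ∈ IsLocalRing.maximalIdeal (D.X.presheaf.stalk D.P) :=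
    fun hu ↦ D.f_mem (hu.map _)
  refine free_of_isPrincipalIdealRing_quotient hfm ?_ (D.isSMulRegular D.f_ne_zero) ha hreg
  rw [D.f_spec]
  exact Ideal.comap_isPrime _ _

end CohenMacaulay

end GeomData

end

theorem mainTheorem3 {k : Type u} [Field k] [CharZero k] {r : ℕ} (D : GeomData.GeometricData k r)
    (hF : GeomData.IsCoherent D.F) :
    (∀ Q ∈ D.C,
      GeomData.IsCohenMacaulay (D.X.presheaf.stalk Q) (GeomData.mstalk D.F Q)) ∧
    (∀ Q ∈ D.C, IsClosed ({Q} : Set D.X) →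
      GeomData.depth (D.X.presheaf.stalk Q) (GeomData.mstalk D.F Q) = 2) ∧
    Module.Free (D.X.presheaf.stalk D.P) (GeomData.mstalk D.F D.P) := by
  refine ⟨fun Q hQ ↦ ?_, fun Q hQC hQ ↦ (D.isCohenMacaulay_of_isClosed hF hQC hQ).2,
    D.free_mstalk hF⟩
  by_cases h : GeomData.gen D.C = Q
  · subst h
    exact D.isCohenMacaulay_gen hF
  · exact (D.isCohenMacaulay_of_isClosed hF hQ (D.isClosed_of_ne_gen hQ h)).1
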